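/- **Setting.** Let $\mathbb F$ be a finite field with $q$ elements, $C$ a geometrically irreducible smooth projective curve over $\mathbb F$, $\infty$ a closed point of $C$, $A=H^0(C\setminus\{\infty\},\mathcal O_C)$ and $K=\operatorname{Frac}A$ the function field of $C$. Let $K_\infty$ be the completion of $K$ at $\infty$, $K_\infty^s$ a separable closure and $\mathbb C_\infty$ its completion, with their canonical absolute value $|\cdot|$. Tensor products without index are over $\mathbb F$. Let $\mathfrak j=\ker(A\otimes K\to K,\ a\otimes c\mapsto ac)$ and let $\tau$ be the map $a\otimes c\mapsto a\otimes c^q$. An $A$-motive over $K$ is a finite projective $A\otimes K$-module $M$ with an isomorphism $\tau_M:(\tau^*M)|_U\to M|_U$ over $U=\operatorname{Spec}(A\otimes K)\setminus V(\mathfrak j)$. For a field $L$ with $K_\infty\subseteq L\subseteq\mathbb C_\infty$ and $\rho\in|L^\times|$, $\rho\ge 1$, let $L\langle A\rangle_\rho$ be the completion of $A\otimes L$ for the norm $\|f\|_\rho=\inf\max_i|\ell_i|\rho^{\deg a_i}$, the infimum being over all representations $f=\sum_i a_i\otimes \ell_i$ with $a_i\neq 0$, where $\deg a=-[\kappa(\infty):\mathbb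 F]\,v_\infty(a)$. Put $L\langle A\rangle=L\langle A\rangle_1$, $\mathfrak X_\rho=\operatorname{Sp}L\langle A\rangle_\rho$, and let $\mathfrak X_L=\bigcup_\rho\mathfrak X_\rho$ be the rigid analytification of $\operatorname{Spec}(A\otimes L)$. The map $\tau$ extends continuously to all these rings. Let $J_m$ be the divisor $\mathfrak j+\tau\mathfrak j+\dots+\tau^m\mathfrak j$ on $\mathfrak X_L$, where $\tau^i\mathfrak j$ is the ideal generated by the image of $\mathfrak j$ under $\tau^i$, and let $\mathcal O_{\mathfrak X}(n\cdot J)=\operatorname{colim}_m\mathcal O_{\mathfrak X}(n\cdot J_m)$ be the sheaf of meromorphic functions with poles of order at most $n$ along $J=\mathfrak j+\tau\mathfrak j+\tau^2\mathfrak j+\cdots$. All $\tau^i\mathfrak j$ generate the unit ideal of $L\langle A\rangle$; hence $\mathcal O_{\mathfrak X}(n\cdot J)(\operatorname{Sp}L\langle A\rangle)=L\langle A\rangle$, and $f\mapsto\tau_M(\tau^*f)$ is defined on $M\otimes_{A\otimes K}L\langle A\rangle$ and on $M\otimes_{A\otimes K}\mathbb C_\infty\langle A\rangle$. For $f\in M\otimes_{A\otimes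 K}\mathcal O_{\mathfrak X}(n\cdot J)(\mathfrak X_L)$ the equation $\tau_M(\tau^*f)=f$ is understood among meromorphic functions with values in $M$. The exponent $\tau_M=1$ denotes the $A$-module of solutions of $\tau_M(\tau^* f)=f$. The Betti realization of $M$ is the $A$-module $$M_B=(M\otimes_{A\otimes K}\mathbb C_\infty\langle A\rangle)^{\tau_M=1},$$ and $M$ is called rigid analytically trivial if the multiplication map $M_B\otimes_A\mathbb C_\infty\langle A\rangle\to M\otimes_{A\otimes K}\mathbb C_\infty\langle A\rangle$ is bijective. **Theorem.** Let $(M,\tau_M)$ be a rigid analytically trivial $A$-motive over $K$, and let $L\subseteq K_\infty^s$ be a finite (separable) extension of $K_\infty$ such that $M_B$ is contained in $M\otimes_{A\otimes K}L\langle A\rangle$. Then the inclusion $L\langle A\rangle\subseteq\mathbb C_\infty\langle A\rangle$ induces an isomorphism of $A$-modules $(M\otimes_{A\otimes K}L\langle A\rangle)^{\tau_M=1}\cong M_B$, and for all sufficiently large integers $n$ the restriction map $\mathcal O_{\mathfrak X}(n\cdot J)(\mathfrak X_L)\to L\langle A\rangle$ induces an isomorphism of $A$-modules $$\bigl(M\otimes_{A\otimes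 K}\mathcal O_{\mathfrak X}(n\cdot J)(\mathfrak X_L)\bigr)^{\tau_M=1}\;\xrightarrow{\ \sim\ }\;(M\otimes_{A\otimes K}L\langle A\rangle)^{\tau_M=1}\cong M_B .$$ -/

import Mathlib

open scoped TensorProduct NNReal WithZero


noncomputable section

namespace AMotive

section Curve

variable (F K : Type*) [Field F] [Field K] [Algebra F K]

/-- `K` is the function field of a smooth projective geometrically irreducible curve over the
finite field `F`: it is finitely generated of transcendence degree one over `F`, and `F` is
algebraically closed in `K`. -/
structure IsCurveFunctionField : Prop where
  fg : (⊤ : IntermediateField F K).FG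
  trdeg_eq_one : Algebra.trdeg F K = 1
  mem_range_of_isAlgebraic : ∀ x : K, IsAlgebraic F x → x ∈ (algebraMap F K).range

/-- A place of `K / F`, i.e. a nontrivial valuation ring of `K` containing `F`. When `K` is the
function field of a smooth projective curve `C`, these are the local rings of the closed points
of `C`. -/
structure Place where
  ring : ValuationSubring K
  algebraMap_mem : ∀ c : F, algebraMap F K c ∈ ring
  ne_top : ring ≠ ⊤

end Curve

section Basic

variable {F K : Type*} [Field F] [Field K] [Algebra F K] (P : Place F K)

instance : Algebra F P.ring :=
  ((algebraMap F K).codRestrict P.ring.toSubring P.algebraMap_mem).toAlgebra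

/-- The ring `A = H⁰(C ∖ {∞}, 𝒪_C)` of functions which are regular away from the closed
point `∞`, written `P`. -/
def regularAway : Subalgebra F K where
  carrier := {f | ∀ Q : Place F K, Q ≠ P → f ∈ Q.ring}
  mul_mem' hf hg Q hQ := mul_mem (hf Q hQ) (hg Q hQ)
  add_mem' hf hg Q hQ := add_mem (hf Q hQ) (hg Q hQ)
  algebraMap_mem' c Q _ := Q.algebraMap_mem c

variable [IsDiscreteValuationRing P.ring]

/-- The normalized discrete valuation of `K` at `∞`, written multiplicatively. -/
def val : Valuation K ℤᵐ⁰ := (IsDiscreteValuationRing.maximalIdeal P.ring).valuation K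

/-- The degree `deg a = - [κ(∞) : F] · v_∞(a)` (with junk value `0` at `a = 0`). -/
def deg (a : K) : ℤ :=
  (Module.finrank F (IsLocalRing.ResidueField P.ring) : ℤ) * WithZero.log (val P a)

variable {P}

lemma val_le_one_iff {x : K} : val P x ≤ 1 ↔ x ∈ P.ring := by
  constructor
  · intro h
    obtain ⟨a, rfl⟩ := IsDiscreteValuationRing.exists_lift_of_le_one h
    exact a.2
  · intro h
    exact (IsDiscreteValuationRing.maximalIdeal P.ring).valuation_le_one (K := K) ⟨x, h⟩

/-- A nonzero element of `A` does not vanish at `∞`. -/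
lemma one_le_val [Fintype F] {a : K} (ha : a ∈ regularAway P) (h0 : a ≠ 0) : 1 ≤ val P a := by
  by_contra! hlt
  have hmem : ∀ V : ValuationSubring K, (∀ c : F, algebraMap F K c ∈ V) → a ∈ V := by
    intro V hV
    by_cases htop : V = ⊤
    · rw [htop]; trivial
    · by_cases hP : (⟨V, hV, htop⟩ : Place F K) = P
      · have := val_le_one_iff.1 hlt.le
        rw [← hP] at this
        exact this
      · exact ha _ hP
  have hint : a ∈ (integralClosure (Subring.closure (Set.range (algebraMap F K))) K).toSubring := by
    rw [← iInf_valuationSubring_superset, Subring.mem_iInf]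
    exact fun V ↦ hmem V.1 fun c ↦ V.2 ⟨c, rfl⟩
  have hcl : Subring.closure (Set.range (algebraMap F K)) = (algebraMap F K).range := by
    rw [← RingHom.coe_range, Subring.closure_eq]
  rw [hcl] at hint
  have halg : IsIntegral F a := by
    obtain ⟨p, hp, hpa⟩ := hint
    obtain ⟨p', hp', hdeg, hmon⟩ := Polynomial.lifts_and_degree_eq_and_monic
      (f := (algebraMap F K).rangeRestrict)
      ((Polynomial.lifts_iff_coeffs_subset_range p).2 (by
        rintro x -
        exact (algebraMap F K).rangeRestrict_surjective x)) hp
    refine ⟨p', hmon, ?_⟩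
    rw [← hp', Polynomial.eval₂_map] at hpa
    exact hpa
  have hfin : Finite (IntermediateField.adjoin F {a}) := by
    have := IntermediateField.adjoin.finiteDimensional halg
    exact Module.finite_of_finite F
  let b : (IntermediateField.adjoin F {a})ˣ :=
    Units.mk0 ⟨a, IntermediateField.mem_adjoin_simple_self F a⟩ (by
      intro h; exact h0 (congrArg Subtype.val h))
  obtain ⟨n, hn, hb⟩ := (isOfFinOrder_of_finite b).exists_pow_eq_one
  have han : a ^ n = 1 := by
    have := congrArg (fun u : (IntermediateField.adjoin F {a})ˣ ↦ ((u : _) : K)) hb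
    simpa [b] using this
  have : val P a ^ n = 1 := by rw [← map_pow, han, map_one]
  have h2 : val P a ^ n < 1 := pow_lt_one₀ zero_le hlt hn.ne'
  exact h2.ne this

lemma deg_nonneg [Fintype F] {a : K} (ha : a ∈ regularAway P) (h0 : a ≠ 0) : 0 ≤ deg P a := by
  refine mul_nonneg (by positivity) ?_
  rw [← WithZero.log_one, WithZero.log_le_log one_ne_zero ((Valuation.ne_zero_iff _).2 h0)]
  exact one_le_val ha h0

lemma deg_mul {a b : K} (ha : a ≠ 0) (hb : b ≠ 0) : deg P (a * b) = deg P a + deg P b := by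
  rw [deg, map_mul, WithZero.log_mul ((Valuation.ne_zero_iff _).2 ha)
    ((Valuation.ne_zero_iff _).2 hb), mul_add]; rfl

lemma deg_one : deg P (1 : K) = 0 := by simp [deg]

end Basic

section Fields

variable {F K : Type*} [Field F] [Fintype F] [Field K] [Algebra F K] (P : Place F K)
  [IsDiscreteValuationRing P.ring]

/-- The completion `K_∞` of `K` at `∞`. -/
def Kinf : Type _ := (IsDiscreteValuationRing.maximalIdeal P.ring).adicCompletion K

instance : Field (Kinf P) := inferInstanceAs
  (Field ((IsDiscreteValuationRing.maximalIdeal P.ring).adicCompletion K))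

instance : Valued (Kinf P) ℤᵐ⁰ := inferInstanceAs
  (Valued ((IsDiscreteValuationRing.maximalIdeal P.ring).adicCompletion K) ℤᵐ⁰)

instance : Algebra K (Kinf P) := inferInstanceAs
  (Algebra K ((IsDiscreteValuationRing.maximalIdeal P.ring).adicCompletion K))

instance : Algebra F (Kinf P) := ((algebraMap K (Kinf P)).comp (algebraMap F K)).toAlgebra

instance : IsScalarTower F K (Kinf P) := .of_algebraMap_eq fun _ ↦ rfl

lemma one_lt_card_nnreal : 1 < (Fintype.card F : ℝ≥0) := by
  exact_mod_cast Fintype.one_lt_card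

instance : (Valued.v : Valuation (Kinf P) ℤᵐ⁰).IsRankOneDiscrete := inferInstanceAs
  (Valued.v : Valuation ((IsDiscreteValuationRing.maximalIdeal P.ring).adicCompletion K)
    ℤᵐ⁰).IsRankOneDiscrete

/-- The canonical absolute value `|x| = q ^ (- v_∞(x))` of `K_∞`, where `q = #F`. -/
instance : (Valued.v : Valuation (Kinf P) ℤᵐ⁰).RankOne :=
  Valuation.IsRankOneDiscrete.rankOne _ (one_lt_card_nnreal (F := F))

instance : NontriviallyNormedField (Kinf P) := Valued.toNontriviallyNormedField (Kinf P) ℤᵐ⁰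

instance : IsUltrametricDist (Kinf P) :=
  inferInstanceAs (@IsUltrametricDist (Kinf P) (Valued.toNormedField (Kinf P) ℤᵐ⁰).toDist)

instance : CompleteSpace (Kinf P) := inferInstanceAs
  (CompleteSpace ((IsDiscreteValuationRing.maximalIdeal P.ring).adicCompletion K))

/-- The separable closure of `K_∞`, with the unique extension of the absolute value. -/
def Ksep : Type _ := SeparableClosure (Kinf P)

instance : Field (Ksep P) := inferInstanceAs (Field (SeparableClosure (Kinf P)))

instance : Algebra (Kinf P) (Ksep P) :=
  inferInstanceAs (Algebra (Kinf P) (SeparableClosure (Kinf P)))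

instance : IsSepClosure (Kinf P) (Ksep P) :=
  inferInstanceAs (IsSepClosure (Kinf P) (SeparableClosure (Kinf P)))

instance : Algebra.IsAlgebraic (Kinf P) (Ksep P) :=
  inferInstanceAs (Algebra.IsAlgebraic (Kinf P) (SeparableClosure (Kinf P)))

instance : NontriviallyNormedField (Ksep P) :=
  spectralNorm.nontriviallyNormedField (Kinf P) (Ksep P)

instance : NormedAlgebra (Kinf P) (Ksep P) := spectralNorm.normedAlgebra (Kinf P) (Ksep P)

instance : Algebra K (Ksep P) := ((algebraMap (Kinf P) (Ksep P)).comp (algebraMap K _)).toAlgebra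

instance : Algebra F (Ksep P) := ((algebraMap (Kinf P) (Ksep P)).comp (algebraMap F _)).toAlgebra

instance : IsScalarTower K (Kinf P) (Ksep P) := .of_algebraMap_eq fun _ ↦ rfl
instance : IsScalarTower F (Kinf P) (Ksep P) := .of_algebraMap_eq fun _ ↦ rfl
instance : IsScalarTower F K (Ksep P) := .of_algebraMap_eq fun _ ↦ rfl

/-- The field `ℂ_∞`: the completion of the separable closure of `K_∞`. -/
def Cinf : Type _ := UniformSpace.Completion (Ksep P)

instance : NormedField (Cinf P) := inferInstanceAs (NormedField (UniformSpace.Completion (Ksep P)))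

/-- The inclusion of the separable closure of `K_∞` in `ℂ_∞`. -/
instance : Algebra (Ksep P) (Cinf P) :=
  (UniformSpace.Completion.coeRingHom (α := Ksep P)).toAlgebra

instance : Algebra K (Cinf P) := ((algebraMap (Ksep P) (Cinf P)).comp (algebraMap K _)).toAlgebra

instance : Algebra F (Cinf P) := ((algebraMap (Ksep P) (Cinf P)).comp (algebraMap F _)).toAlgebra

instance : IsScalarTower K (Ksep P) (Cinf P) := .of_algebraMap_eq fun _ ↦ rfl
instance : IsScalarTower F (Ksep P) (Cinf P) := .of_algebraMap_eq fun _ ↦ rfl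
instance : IsScalarTower F K (Cinf P) := .of_algebraMap_eq fun _ ↦ rfl

variable (L : IntermediateField (Kinf P) (Ksep P))

instance : IsScalarTower F K L := .of_algebraMap_eq fun _ ↦ rfl

lemma norm_algebraMap_Cinf (x : Ksep P) : ‖algebraMap (Ksep P) (Cinf P) x‖ = ‖x‖ :=
  UniformSpace.Completion.norm_coe x

variable {P} in
lemma one_lt_norm_Kinf {a : K} (ha : a ∉ P.ring) : 1 < ‖algebraMap K (Kinf P) a‖ := by
  rw [← val_le_one_iff, not_le] at ha
  refine Valued.toNormedField.one_lt_norm_iff.2 ?_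
  have : Valued.v (algebraMap K (Kinf P) a) = val P a :=
    IsDedekindDomain.HeightOneSpectrum.valuedAdicCompletion_eq_valuation' _ a
  rwa [this]

end Fields

section TensorRing

variable {F K : Type*} [Field F] [Field K] [Algebra F K] (P : Place F K)

/-- The ring `A ⊗ R` (tensor product over `F`), for an `F`-algebra `R`. -/
def AT (R : Type*) [CommRing R] [Algebra F R] : Type _ := regularAway P ⊗[F] R

variable (R : Type*) [CommRing R] [Algebra F R]

instance : CommRing (AT P R) := inferInstanceAs (CommRing (regularAway P ⊗[F] R))

instance : Algebra (regularAway P) (AT P R) :=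
  inferInstanceAs (Algebra (regularAway P) (regularAway P ⊗[F] R))

variable {P R}

/-- The pure tensor `a ⊗ c` in `A ⊗ R`. -/
def AT.mk (a : regularAway P) (c : R) : AT P R := a ⊗ₜ[F] c

lemma AT.mk_mul (a b : regularAway P) (c d : R) :
    AT.mk a c * AT.mk b d = AT.mk (a * b) (c * d) :=
  Algebra.TensorProduct.tmul_mul_tmul a b c d

lemma AT.mk_neg (a : regularAway P) (c : R) : AT.mk a (-c) = - AT.mk a c :=
  TensorProduct.tmul_neg a c

lemma AT.one_def : (1 : AT P R) = AT.mk 1 1 := rfl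

lemma AT.zero_mk (c : R) : (AT.mk 0 c : AT P R) = 0 := TensorProduct.zero_tmul _ c

@[elab_as_elim]
lemma AT.induction {p : AT P R → Prop} (x : AT P R) (zero : p 0)
    (mk : ∀ a c, p (AT.mk a c)) (add : ∀ x y, p x → p y → p (x + y)) : p x :=
  TensorProduct.induction_on x zero mk add

variable (P) in
/-- The homomorphism `A ⊗ R → A ⊗ S`, `a ⊗ c ↦ a ⊗ f c`. -/
def AT.map {S : Type*} [CommRing S] [Algebra F S] (f : R →ₐ[F] S) :
    AT P R →ₐ[regularAway P] AT P S :=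
  Algebra.TensorProduct.map (AlgHom.id _ _) f

@[simp]
lemma AT.map_mk {S : Type*} [CommRing S] [Algebra F S] (f : R →ₐ[F] S) (a : regularAway P)
    (c : R) : AT.map P f (AT.mk a c) = AT.mk a (f c) := rfl

variable (P R) in
/-- The endomorphism `τ` of `A ⊗ R`: `a ⊗ c ↦ a ⊗ c ^ q`, where `q = #F`. -/
def tau [Fintype F] : AT P R →ₐ[regularAway P] AT P R :=
  AT.map P (FiniteField.frobeniusAlgHom F R)

@[simp]
lemma tau_mk [Fintype F] (a : regularAway P) (c : R) :
    tau P R (AT.mk a c) = AT.mk a (c ^ Fintype.card F) := rfl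

lemma map_tau [Fintype F] {S : Type*} [CommRing S] [Algebra F S] (f : R →ₐ[F] S) (x : AT P R) :
    AT.map P f (tau P R x) = tau P S (AT.map P f x) := by
  induction x using AT.induction with
  | zero => simp
  | mk a c => simp
  | add x y hx hy => simp [hx, hy]

end TensorRing

section Motives

variable {F K : Type*} [Field F] [Fintype F] [Field K] [Algebra F K] (P : Place F K)

/-- The multiplication map `A ⊗ K → K`, `a ⊗ c ↦ a c`. -/
def mulMap : AT P K →+* K :=
  (Algebra.TensorProduct.productMap (regularAway P).val (AlgHom.id F K)).toRingHom

/-- The ideal `𝔧` of `A ⊗ K`: the kernel of the multiplication map `A ⊗ K → K`. -/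
def jIdeal : Ideal (AT P K) := RingHom.ker (mulMap P)

/-- The ideal `τ^i 𝔧`, generated by the image of `𝔧` under the `i`-th iterate of `τ`. -/
def jTwist (i : ℕ) : Ideal (AT P K) := (jIdeal P).map ((tau P K : AT P K →+* AT P K) ^ i)

/-- The ideal of the effective divisor `J_m = 𝔧 + τ𝔧 + ... + τ^m 𝔧`. -/
def JIdeal (m : ℕ) : Ideal (AT P K) := ∏ i ∈ Finset.range (m + 1), jTwist P i

lemma JIdeal_anti : Antitone (JIdeal P) := by
  refine antitone_nat_of_succ_le fun m ↦ ?_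
  rw [JIdeal, JIdeal, Finset.prod_range_succ _ (m + 1)]
  exact Ideal.mul_le_left

/-- The multiplicative subset of `A ⊗ K` generated by the (nonzero) elements
`a ⊗ 1 - 1 ⊗ a ^ (q ^ i)`, for `a ∈ A` with a pole at `∞`, i.e. `a` nonconstant. Each `τ^i 𝔧`
contains such elements, so that every function whose poles lie on finitely many of the `τ^i 𝔧`
becomes regular after multiplication by an element of this set. -/
def poleSet : Submonoid (AT P K) :=
  Submonoid.closure {b | ∃ a : regularAway P, (a : K) ∉ P.ring ∧ ∃ i : ℕ,
    b = AT.mk a 1 - AT.mk 1 ((a : K) ^ Fintype.card F ^ i)}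

lemma tau_mem_poleSet {b : AT P K} (hb : b ∈ poleSet P) : tau P K b ∈ poleSet P := by
  suffices h : poleSet P ≤ (poleSet P).comap (tau P K) from h hb
  refine Submonoid.closure_le.2 ?_
  rintro _ ⟨a, ha, i, rfl⟩
  refine Submonoid.subset_closure ⟨a, ha, i + 1, ?_⟩
  simp [pow_succ, pow_mul]

/-- The localization of `A ⊗ K` at `poleSet`, a ring of meromorphic functions on
`Spec (A ⊗ K)`. -/
def PoleLoc : Type _ := Localization (poleSet P)

instance : CommRing (PoleLoc P) := inferInstanceAs (CommRing (Localization (poleSet P)))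

instance : Algebra (AT P K) (PoleLoc P) :=
  inferInstanceAs (Algebra (AT P K) (Localization (poleSet P)))

instance : IsLocalization (poleSet P) (PoleLoc P) :=
  inferInstanceAs (IsLocalization (poleSet P) (Localization (poleSet P)))

/-- The ring of functions on the complement of `V(𝔧)` in `Spec (A ⊗ K)`: the fractions `x`
with `𝔧 ^ n • x ⊆ A ⊗ K` for some `n`. -/
def jComplement : Subalgebra (AT P K) (PoleLoc P) where
  carrier := {x | ∃ n : ℕ, ∀ g ∈ jIdeal P ^ n, g • x ∈ (algebraMap (AT P K) (PoleLoc P)).range}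
  mul_mem' := by
    rintro x y ⟨n, hx⟩ ⟨m, hy⟩
    refine ⟨n + m, fun g hg ↦ ?_⟩
    rw [pow_add] at hg
    induction hg using Submodule.mul_induction_on' with
    | mem_mul_mem a ha b hb =>
      have : (a * b) • (x * y) = (a • x) * (b • y) := by
        rw [mul_smul, smul_mul_assoc, mul_smul_comm]
      rw [this]
      exact mul_mem (hx a ha) (hy b hb)
    | add a _ b _ ha hb => rw [add_smul]; exact add_mem ha hb
  add_mem' := by
    rintro x y ⟨n, hx⟩ ⟨m, hy⟩
    refine ⟨n + m, fun g hg ↦ ?_⟩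
    rw [smul_add]
    exact add_mem (hx g (Ideal.pow_le_pow_right (by omega) hg))
      (hy g (Ideal.pow_le_pow_right (by omega) hg))
  algebraMap_mem' b := ⟨0, fun g _ ↦ ⟨g * b, by rw [map_mul, Algebra.smul_def]⟩⟩

/-- The ring `jComplement P`, considered as an algebra over `A ⊗ K` through `τ`. -/
def FrobTwist : Type _ := jComplement P

instance : CommRing (FrobTwist P) := inferInstanceAs (CommRing (jComplement P))

instance : Algebra (jComplement P) (FrobTwist P) :=
  inferInstanceAs (Algebra (jComplement P) (jComplement P))

instance : Algebra (AT P K) (FrobTwist P) :=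
  ((algebraMap (jComplement P) (FrobTwist P)).comp
    ((algebraMap (AT P K) (jComplement P)).comp (tau P K : AT P K →+* AT P K))).toAlgebra

lemma algebraMap_frobTwist (b : AT P K) : algebraMap (AT P K) (FrobTwist P) b =
    algebraMap (jComplement P) (FrobTwist P) (algebraMap (AT P K) (jComplement P) (tau P K b)) := rfl

/-- The structure of an `A`-motive over `K` on a (finite projective) `A ⊗ K`-module `M`: an
isomorphism `τ_M : (τ^* M)|_U ≃ M|_U` over the complement `U` of `V(𝔧)` in `Spec (A ⊗ K)`. -/
structure MotiveStructure (M : Type*) [AddCommGroup M] [Module (AT P K) M] where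
  frob : (FrobTwist P ⊗[AT P K] M) ≃ₗ[jComplement P] (jComplement P ⊗[AT P K] M)

section FixedPoints

variable {P}
variable {M : Type*} [AddCommGroup M] [Module (AT P K) M] (T : MotiveStructure P M)
variable {E : Type*} [CommRing E] [Algebra (AT P K) E]

/-- For a ring `E` over the complement of `V(𝔧)` (through `κ`), the map `m ↦ τ_M(τ^* m)` from `M`
to `E ⊗ M`. -/
def MotiveStructure.frobVec (κ : jComplement P →ₐ[AT P K] E) : M →+ E ⊗[AT P K] M where
  toFun m := LinearMap.rTensor M κ.toLinearMap (T.frob (1 ⊗ₜ m))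
  map_zero' := by simp
  map_add' := by simp [TensorProduct.tmul_add]

lemma MotiveStructure.frobVec_smul (κ : jComplement P →ₐ[AT P K] E) (b : AT P K) (m : M) :
    T.frobVec κ (b • m) = tau P K b • T.frobVec κ m := by
  have h : (1 : FrobTwist P) ⊗ₜ[AT P K] (b • m) =
      (algebraMap (AT P K) (jComplement P) (tau P K b)) • ((1 : FrobTwist P) ⊗ₜ[AT P K] m) := by
    rw [← TensorProduct.smul_tmul, TensorProduct.smul_tmul', Algebra.smul_def, Algebra.smul_def,
      algebraMap_frobTwist]
  simp only [MotiveStructure.frobVec, AddMonoidHom.coe_mk, ZeroHom.coe_mk]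
  rw [h, map_smul, algebraMap_smul, map_smul]

/-- The `τ`-semilinear map `f ↦ τ_M(τ^* f)` on `E ⊗ M`, for an algebra `E` as above with an
endomorphism `σ` compatible with `τ`. -/
def MotiveStructure.act (κ : jComplement P →ₐ[AT P K] E) (σ : E →+* E)
    (hσ : ∀ b, σ (algebraMap (AT P K) E b) = algebraMap (AT P K) E (tau P K b)) :
    E ⊗[AT P K] M →+ E ⊗[AT P K] M :=
  TensorProduct.liftAddHom
    { toFun := fun e ↦ (DistribSMul.toAddMonoidHom (E ⊗[AT P K] M) (σ e)).comp (T.frobVec κ)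
      map_zero' := by ext; simp
      map_add' := fun x y ↦ by ext; simp [add_smul] }
    (fun b e m ↦ by
      simp only [AddMonoidHom.coe_mk, ZeroHom.coe_mk, AddMonoidHom.comp_apply,
        DistribSMul.toAddMonoidHom_apply, T.frobVec_smul]
      rw [Algebra.smul_def, map_mul, hσ, mul_smul, algebraMap_smul, smul_comm])

end FixedPoints
end Motives

section Gauss

variable {F K : Type*} [Field F] [Field K] [Algebra F K] (P : Place F K)
  [IsDiscreteValuationRing P.ring]
variable (L : Type*) [NormedField L] [Algebra F L]

/-- The radii `ρ ∈ |L^×|` with `ρ ≥ 1`. -/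
def Radius : Type := {ρ : ℝ // 1 ≤ ρ ∧ ∃ c : L, ‖c‖ = ρ}

instance : LE (Radius L) := ⟨fun ρ ρ' ↦ ρ.1 ≤ ρ'.1⟩

instance : One (Radius L) := ⟨⟨1, le_rfl, 1, norm_one⟩⟩

variable {L}

/-- The elements of `A ⊗ L` which are finite sums of tensors `a ⊗ ℓ` with `|ℓ| ρ ^ (deg a) ≤ r`. -/
def gaussBall (ρ : Radius L) (r : ℝ) : AddSubgroup (AT P L) :=
  AddSubgroup.closure {f | ∃ (a : regularAway P) (l : L), a ≠ 0 ∧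
    ‖l‖ * ρ.1 ^ deg P (a : K) ≤ r ∧ f = AT.mk a l}

/-- The Gauss norm `‖f‖_ρ` on `A ⊗ L`: the infimum of `max_i |ℓ_i| ρ ^ (deg a_i)` over all
representations `f = ∑ i, a_i ⊗ ℓ_i`. -/
def gaussNorm (ρ : Radius L) (f : AT P L) : ℝ := sInf {r : ℝ | 0 ≤ r ∧ f ∈ gaussBall P ρ r}

variable {P}

lemma gaussBall_mono (ρ : Radius L) : Monotone (gaussBall P ρ) := by
  intro r s hrs
  refine AddSubgroup.closure_mono ?_
  rintro f ⟨a, l, ha, h, rfl⟩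
  exact ⟨a, l, ha, h.trans hrs, rfl⟩

lemma exists_mem_gaussBall (ρ : Radius L) (f : AT P L) : ∃ r, 0 ≤ r ∧ f ∈ gaussBall P ρ r := by
  induction f using AT.induction with
  | zero => exact ⟨0, le_rfl, zero_mem _⟩
  | mk a c =>
    by_cases ha : a = 0
    · subst ha; exact ⟨0, le_rfl, by rw [AT.zero_mk]; exact zero_mem _⟩
    · have := ρ.2.1
      exact ⟨‖c‖ * ρ.1 ^ deg P (a : K), by positivity,
        AddSubgroup.subset_closure ⟨a, c, ha, le_rfl, rfl⟩⟩
  | add x y hx hy =>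
    obtain ⟨r, hr, hx⟩ := hx
    obtain ⟨s, hs, hy⟩ := hy
    exact ⟨max r s, hr.trans (le_max_left _ _), add_mem
      (gaussBall_mono ρ (le_max_left _ _) hx) (gaussBall_mono ρ (le_max_right _ _) hy)⟩

lemma gaussNorm_nonneg (ρ : Radius L) (f : AT P L) : 0 ≤ gaussNorm P ρ f :=
  Real.sInf_nonneg fun _ h ↦ h.1

lemma gaussNorm_le {ρ : Radius L} {f : AT P L} {r : ℝ} (hr : 0 ≤ r) (h : f ∈ gaussBall P ρ r) :
    gaussNorm P ρ f ≤ r := csInf_le ⟨0, fun _ h ↦ h.1⟩ ⟨hr, h⟩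

lemma mem_gaussBall_of_lt {ρ : Radius L} {f : AT P L} {r : ℝ} (h : gaussNorm P ρ f < r) :
    f ∈ gaussBall P ρ r := by
  obtain ⟨r₀, hr₀, hf⟩ := exists_mem_gaussBall ρ f
  have hne : {r : ℝ | 0 ≤ r ∧ f ∈ gaussBall P ρ r}.Nonempty := ⟨r₀, hr₀, hf⟩
  obtain ⟨s, ⟨-, hs⟩, hsr⟩ := exists_lt_of_csInf_lt hne h
  exact gaussBall_mono ρ hsr.le hs

lemma mul_mem_gaussBall {ρ : Radius L} {f g : AT P L} {r s : ℝ} (hr : 0 ≤ r)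
    (hf : f ∈ gaussBall P ρ r) (hg : g ∈ gaussBall P ρ s) : f * g ∈ gaussBall P ρ (r * s) := by
  have hρ : 0 < ρ.1 := one_pos.trans_le ρ.2.1
  refine AddSubgroup.closure_induction ?_ ?_ ?_ ?_ hf
  · rintro _ ⟨a, l, ha, hl, rfl⟩
    refine AddSubgroup.closure_induction ?_ ?_ ?_ ?_ hg
    · rintro _ ⟨b, m, hb, hm, rfl⟩
      refine AddSubgroup.subset_closure ⟨a * b, l * m, mul_ne_zero ha hb, ?_, AT.mk_mul ..⟩
      have ha' : (a : K) ≠ 0 := by simpa using ha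
      have hb' : (b : K) ≠ 0 := by simpa using hb
      rw [MulMemClass.coe_mul, deg_mul ha' hb', zpow_add₀ hρ.ne', norm_mul]
      calc _ = (‖l‖ * ρ.1 ^ deg P (a : K)) * (‖m‖ * ρ.1 ^ deg P (b : K)) := by ring
        _ ≤ r * s := mul_le_mul hl hm (by positivity) hr
    · simp
    · intro x y _ _ hx hy; rw [mul_add]; exact add_mem hx hy
    · intro x _ hx; rw [mul_neg]; exact neg_mem hx
  · simp
  · intro x y _ _ hx hy; rw [add_mul]; exact add_mem hx hy
  · intro x _ hx; rw [neg_mul]; exact neg_mem hx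

variable (P) in
/-- The Gauss norm `‖·‖_ρ`, as a submultiplicative seminorm on the ring `A ⊗ L`. -/
def gaussSeminorm (ρ : Radius L) : RingSeminorm (AT P L) where
  toFun := gaussNorm P ρ
  map_zero' := le_antisymm (gaussNorm_le le_rfl (zero_mem _)) (gaussNorm_nonneg _ _)
  add_le' f g := by
    refine le_of_forall_pos_le_add fun ε hε ↦ ?_
    have hf := gaussNorm_nonneg ρ f
    have hg := gaussNorm_nonneg ρ g
    refine gaussNorm_le (by positivity) (add_mem ?_ ?_)
    · exact mem_gaussBall_of_lt (by linarith)
    · exact mem_gaussBall_of_lt (by linarith)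
  neg' f := by
    have h : ∀ g : AT P L, gaussNorm P ρ (-g) ≤ gaussNorm P ρ g := fun g ↦ by
      refine le_of_forall_pos_le_add fun ε hε ↦ gaussNorm_le ?_ ?_
      · have := gaussNorm_nonneg ρ g; positivity
      · exact neg_mem (mem_gaussBall_of_lt (by linarith))
    exact le_antisymm (h f) (by simpa using h (-f))
  mul_le' f g := by
    have hf := gaussNorm_nonneg ρ f
    have hg := gaussNorm_nonneg ρ g
    have key : ∀ ε : ℝ, 0 < ε → gaussNorm P ρ (f * g) ≤
        (gaussNorm P ρ f + ε) * (gaussNorm P ρ g + ε) := fun ε hε ↦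
      gaussNorm_le (by positivity) (mul_mem_gaussBall (by positivity)
        (mem_gaussBall_of_lt (by linarith)) (mem_gaussBall_of_lt (by linarith)))
    have hc : Continuous fun ε ↦ (gaussNorm P ρ f + ε) * (gaussNorm P ρ g + ε) := by fun_prop
    have ht : Filter.Tendsto (fun ε ↦ (gaussNorm P ρ f + ε) * (gaussNorm P ρ g + ε))
        (nhdsWithin (0 : ℝ) (Set.Ioi 0)) (nhds (gaussNorm P ρ f * gaussNorm P ρ g)) := by
      simpa using (hc.tendsto 0).mono_left nhdsWithin_le_nhds
    exact ge_of_tendsto ht (eventually_mem_nhdsWithin.mono fun ε hε ↦ key ε hε)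

variable (P) in
/-- The ring `A ⊗ L`, endowed with the Gauss norm `‖·‖_ρ`. -/
def GaussRing (_ : Radius L) : Type _ := AT P L

instance (ρ : Radius L) : SeminormedCommRing (GaussRing P ρ) :=
  { (gaussSeminorm P ρ).toSeminormedRing with mul_comm := mul_comm (G := AT P L) }

/-- The identity map from `A ⊗ L` to the same ring with its Gauss norm. -/
def GaussRing.equiv (ρ : Radius L) : AT P L ≃+* GaussRing P ρ where
  toFun x := x
  invFun x := x
  left_inv _ := rfl
  right_inv _ := rfl
  map_mul' _ _ := rfl
  map_add' _ _ := rfl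

lemma GaussRing.norm_def {ρ : Radius L} (f : AT P L) :
    ‖GaussRing.equiv ρ f‖ = gaussNorm P ρ f := rfl

/-- A ring homomorphism `A ⊗ L → A ⊗ L'`, seen between these rings with Gauss norms. -/
def GaussRing.hom {L' : Type*} [NormedField L'] [Algebra F L'] (ρ : Radius L) (ρ' : Radius L')
    (φ : AT P L →+* AT P L') : GaussRing P ρ →+* GaussRing P ρ' :=
  ((GaussRing.equiv ρ').toRingHom.comp φ).comp (GaussRing.equiv ρ).symm.toRingHom

lemma GaussRing.continuous_hom {L' : Type*} [NormedField L'] [Algebra F L'] {ρ : Radius L}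
    {ρ' : Radius L'} (φ : AT P L →+* AT P L')
    (h : ∀ r : ℝ, 0 ≤ r → r ≤ 1 → ∀ (a : regularAway P) (l : L), a ≠ 0 →
      ‖l‖ * ρ.1 ^ deg P (a : K) ≤ r → φ (AT.mk a l) ∈ gaussBall P ρ' r) :
    Continuous (GaussRing.hom ρ ρ' φ) := by
  refine continuous_of_continuousAt_zero (GaussRing.hom ρ ρ' φ) ?_
  rw [Metric.continuousAt_iff]
  intro ε hε
  refine ⟨min (ε / 2) 1, by positivity, fun {x} hx ↦ ?_⟩
  rw [map_zero, dist_zero_right]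
  rw [dist_zero_right] at hx
  obtain ⟨x, rfl⟩ := (GaussRing.equiv ρ).surjective x
  rw [GaussRing.norm_def] at hx
  have hmem := mem_gaussBall_of_lt hx
  have hpos : (0 : ℝ) ≤ min (ε / 2) 1 := by positivity
  have : φ x ∈ gaussBall P ρ' (min (ε / 2) 1) := by
    refine AddSubgroup.closure_induction
      (p := fun y _ ↦ φ y ∈ gaussBall P ρ' (min (ε / 2) 1)) ?_ ?_ ?_ ?_ hmem
    · rintro _ ⟨a, l, ha, hl, rfl⟩
      exact h _ hpos (min_le_right _ _) a l ha hl
    · rw [map_zero]; exact zero_mem _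
    · intro x y _ _ hx hy
      rw [map_add]; exact add_mem hx hy
    · intro x _ hx
      rw [map_neg]; exact neg_mem hx
  calc gaussNorm P ρ' (φ x) ≤ min (ε / 2) 1 := gaussNorm_le hpos this
    _ ≤ ε / 2 := min_le_left _ _
    _ < ε := by linarith

variable (P) in
/-- The affinoid algebra `L⟨A⟩_ρ`: the completion of `A ⊗ L` for the Gauss norm `‖·‖_ρ`. For
`ρ = 1` this is the Tate algebra `L⟨A⟩`. -/
def Tate (ρ : Radius L) : Type _ := UniformSpace.Completion (GaussRing P ρ)

instance (ρ : Radius L) : NormedCommRing (Tate P ρ) :=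
  inferInstanceAs (NormedCommRing (UniformSpace.Completion (GaussRing P ρ)))

instance (ρ : Radius L) : CompleteSpace (Tate P ρ) :=
  inferInstanceAs (CompleteSpace (UniformSpace.Completion (GaussRing P ρ)))

/-- The canonical map `A ⊗ L → L⟨A⟩_ρ`. -/
def Tate.of (ρ : Radius L) : AT P L →+* Tate P ρ :=
  (UniformSpace.Completion.coeRingHom : GaussRing P ρ →+* _).comp (GaussRing.equiv ρ).toRingHom

/-- The continuous extension `L⟨A⟩_ρ → L'⟨A⟩_ρ'` of a continuous homomorphism. -/
def Tate.map {L' : Type*} [NormedField L'] [Algebra F L'] {ρ : Radius L} {ρ' : Radius L'}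
    (φ : AT P L →+* AT P L') (h : Continuous (GaussRing.hom ρ ρ' φ)) : Tate P ρ →+* Tate P ρ' :=
  UniformSpace.Completion.mapRingHom _ h

lemma Tate.map_of {L' : Type*} [NormedField L'] [Algebra F L'] {ρ : Radius L} {ρ' : Radius L'}
    (φ : AT P L →+* AT P L') (h : Continuous (GaussRing.hom ρ ρ' φ)) (x : AT P L) :
    Tate.map φ h (Tate.of ρ x) = Tate.of ρ' (φ x) :=
  UniformSpace.Completion.mapRingHom_coe h _

lemma norm_tate_of (ρ : Radius L) (x : AT P L) : ‖Tate.of ρ x‖ = gaussNorm P ρ x :=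
  UniformSpace.Completion.norm_coe (GaussRing.equiv ρ x)

lemma continuous_id_gauss [Fintype F] {ρ ρ' : Radius L} (h : ρ ≤ ρ') :
    Continuous (GaussRing.hom ρ' ρ (RingHom.id (AT P L))) := by
  refine GaussRing.continuous_hom _ fun r _ _ a l ha hl ↦ ?_
  have ha' : (a : K) ≠ 0 := by simpa using ha
  refine AddSubgroup.subset_closure ⟨a, l, ha, le_trans ?_ hl, rfl⟩
  lift deg P (a : K) to ℕ using deg_nonneg a.2 ha' with d
  have := ρ.2.1
  have h' : ρ.1 ≤ ρ'.1 := h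
  simp only [zpow_natCast]
  gcongr

lemma continuous_tau [Fintype F] (ρ : Radius L) :
    Continuous (GaussRing.hom ρ ρ (tau P L : AT P L →+* AT P L)) := by
  refine GaussRing.continuous_hom _ fun r hr0 hr1 a l ha hl ↦ ?_
  have ha' : (a : K) ≠ 0 := by simpa using ha
  refine AddSubgroup.subset_closure ⟨a, l ^ Fintype.card F, ha, ?_, rfl⟩
  lift deg P (a : K) to ℕ using deg_nonneg a.2 ha' with d
  have h1 : 1 ≤ ρ.1 ^ d := one_le_pow₀ ρ.2.1
  have hq : Fintype.card F ≠ 0 := Fintype.card_ne_zero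
  simp only [zpow_natCast] at hl ⊢
  calc ‖l ^ Fintype.card F‖ * ρ.1 ^ d ≤ ‖l‖ ^ Fintype.card F * (ρ.1 ^ d) ^ Fintype.card F := by
        rw [norm_pow]; gcongr; exact le_self_pow₀ h1 hq
    _ = (‖l‖ * ρ.1 ^ d) ^ Fintype.card F := (mul_pow _ _ _).symm
    _ ≤ r ^ Fintype.card F := by gcongr
    _ ≤ r := pow_le_of_le_one hr0 hr1 hq

lemma continuous_baseChange {L' : Type*} [NormedField L'] [Algebra F L'] (f : L →ₐ[F] L')
    (hf : ∀ x, ‖f x‖ = ‖x‖) :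
    Continuous
      (GaussRing.hom (1 : Radius L) (1 : Radius L') (AT.map P f : AT P L →+* AT P L')) := by
  refine GaussRing.continuous_hom _ fun r _ _ a l ha hl ↦ ?_
  exact AddSubgroup.subset_closure ⟨a, f l, ha, by rw [hf]; exact hl, rfl⟩

end Gauss

section Analytic

variable {F K : Type*} [Field F] [Fintype F] [Field K] [Algebra F K] {P : Place F K}
  [IsDiscreteValuationRing P.ring]
variable {L : Type*} [NormedField L] [Algebra F L] [Algebra K L] [IsScalarTower F K L]

instance (ρ : Radius L) : Algebra (AT P K) (Tate P ρ) :=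
  ((Tate.of ρ).comp (AT.map P (IsScalarTower.toAlgHom F K L) : AT P K →+* AT P L)).toAlgebra

instance (ρ : Radius L) : Algebra (regularAway P) (Tate P ρ) :=
  ((algebraMap (AT P K) (Tate P ρ)).comp (algebraMap (regularAway P) (AT P K))).toAlgebra

instance (ρ : Radius L) : IsScalarTower (regularAway P) (AT P K) (Tate P ρ) :=
  .of_algebraMap_eq fun _ ↦ rfl

lemma algebraMap_tate (ρ : Radius L) (b : AT P K) : algebraMap (AT P K) (Tate P ρ) b =
    Tate.of ρ (AT.map P (IsScalarTower.toAlgHom F K L) b) := rfl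

/-- The continuous extension of `τ` to `L⟨A⟩_ρ`. -/
def Tate.tau (ρ : Radius L) : Tate P ρ →+* Tate P ρ :=
  Tate.map (AMotive.tau P L : AT P L →+* AT P L) (continuous_tau ρ)

lemma Tate.tau_algebraMap (ρ : Radius L) (b : AT P K) :
    Tate.tau ρ (algebraMap (AT P K) (Tate P ρ) b) =
      algebraMap (AT P K) (Tate P ρ) (AMotive.tau P K b) := by
  rw [algebraMap_tate, algebraMap_tate, map_tau]
  exact Tate.map_of _ _ _

/-- The canonical map `L⟨A⟩_ρ' → L⟨A⟩_ρ` for `ρ ≤ ρ'`. -/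
def Tate.restrict {ρ ρ' : Radius L} (h : ρ ≤ ρ') : Tate P ρ' →ₐ[AT P K] Tate P ρ where
  toRingHom := Tate.map (RingHom.id (AT P L)) (continuous_id_gauss h)
  commutes' _ := Tate.map_of _ _ _

/-- The canonical map `L⟨A⟩ → L'⟨A⟩` for an extension `L'` of `L` of normed fields. -/
def Tate.baseChange {L' : Type*} [NormedField L'] [Algebra F L'] [Algebra K L']
    [IsScalarTower F K L'] (f : L →ₐ[K] L') (hf : ∀ x, ‖f x‖ = ‖x‖) :
    Tate P (1 : Radius L) →ₐ[AT P K] Tate P (1 : Radius L') where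
  toRingHom := Tate.map (AT.map P (f.restrictScalars F) : AT P L →+* AT P L')
    (continuous_baseChange (f.restrictScalars F) hf)
  commutes' b := by
    refine (Tate.map_of _ _ _).trans ?_
    rw [algebraMap_tate]
    congr 1
    induction b using AT.induction with
    | zero => simp
    | mk a c => simp
    | add x y hx hy => simp only [map_add, hx, hy]

/-- The elements of `poleSet` are invertible in the algebra `E` over `A ⊗ K`. -/
class PolesInvertible (P : Place F K) (E : Type*) [CommRing E] [Algebra (AT P K) E] : Prop where
  isUnit : ∀ s ∈ poleSet P, IsUnit (algebraMap (AT P K) E s)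

/-- `L` is a normed extension of `K` in which the elements with a pole at `∞` have absolute value
greater than one. -/
class IsNormedOver (P : Place F K) (L : Type*) [NormedField L] [Algebra K L] : Prop where
  one_lt_norm : ∀ a : K, a ∉ P.ring → 1 < ‖algebraMap K L a‖

instance [IsNormedOver P L] : PolesInvertible P (Tate P (1 : Radius L)) where
  isUnit s hs := by
    suffices h : poleSet P ≤ (IsUnit.submonoid (Tate P (1 : Radius L))).comap
        (algebraMap (AT P K) (Tate P (1 : Radius L))) from h hs
    refine Submonoid.closure_le.2 ?_
    rintro _ ⟨a, ha, i, rfl⟩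
    change IsUnit _
    set c : L := (algebraMap K L a) ^ Fintype.card F ^ i with hc
    have hc1 : 1 < ‖c‖ := by
      rw [hc, norm_pow]
      exact one_lt_pow₀ (IsNormedOver.one_lt_norm (P := P) _ ha)
        (pow_ne_zero _ Fintype.card_ne_zero)
    have hc0 : c ≠ 0 := by rintro h; rw [h, norm_zero] at hc1; linarith
    have ha0 : a ≠ 0 := by rintro rfl; exact ha (zero_mem _)
    have key : algebraMap (AT P K) (Tate P (1 : Radius L))
        (AT.mk a 1 - AT.mk 1 ((a : K) ^ Fintype.card F ^ i)) =
        - (Tate.of 1 (AT.mk 1 c) * (1 - Tate.of 1 (AT.mk a c⁻¹))) := by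
      rw [algebraMap_tate, mul_sub, mul_one, ← map_mul, AT.mk_mul, one_mul,
        mul_inv_cancel₀ hc0, ← map_sub, ← map_neg, map_sub]
      simp [hc]
    rw [key]
    refine (IsUnit.mul ?_ (isUnit_one_sub_of_norm_lt_one ?_)).neg
    · refine IsUnit.map _ (IsUnit.of_mul_eq_one (AT.mk 1 c⁻¹) ?_)
      rw [AT.mk_mul, mul_inv_cancel₀ hc0, one_mul]; rfl
    · rw [norm_tate_of]
      refine (gaussNorm_le (norm_nonneg c⁻¹) ?_).trans_lt ?_
      · refine AddSubgroup.subset_closure ⟨a, c⁻¹, ha0, ?_, rfl⟩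
        rw [show (1 : Radius L).1 = 1 from rfl, one_zpow, mul_one]
      · rw [norm_inv]; exact inv_lt_one_of_one_lt₀ hc1

/-- The structure map `𝒪(U) → E` for an algebra `E` in which the poles are invertible, where `U`
is the complement of `V(𝔧)`. -/
def kappa (P : Place F K) (E : Type*) [CommRing E] [Algebra (AT P K) E] [h : PolesInvertible P E] :
    jComplement P →ₐ[AT P K] E :=
  (IsLocalization.liftAlgHom (M := poleSet P) (S := PoleLoc P) (f := Algebra.ofId (AT P K) E)
    fun s ↦ h.isUnit s s.2).comp (jComplement P).val

variable (P) in
/-- The ring of meromorphic functions on `𝔛_ρ = Sp L⟨A⟩_ρ` which become regular after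
multiplication by an element of `poleSet`. -/
def Mer (ρ : Radius L) : Type _ :=
  Localization (Algebra.algebraMapSubmonoid (Tate P ρ) (poleSet P))

instance (ρ : Radius L) : CommRing (Mer P ρ) := inferInstanceAs
  (CommRing (Localization (Algebra.algebraMapSubmonoid (Tate P ρ) (poleSet P))))

instance (ρ : Radius L) : Algebra (Tate P ρ) (Mer P ρ) := inferInstanceAs
  (Algebra (Tate P ρ) (Localization (Algebra.algebraMapSubmonoid (Tate P ρ) (poleSet P))))

instance (ρ : Radius L) :
    IsLocalization (Algebra.algebraMapSubmonoid (Tate P ρ) (poleSet P)) (Mer P ρ) :=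
  inferInstanceAs (IsLocalization (Algebra.algebraMapSubmonoid (Tate P ρ) (poleSet P))
    (Localization (Algebra.algebraMapSubmonoid (Tate P ρ) (poleSet P))))

instance (ρ : Radius L) : Algebra (AT P K) (Mer P ρ) :=
  ((algebraMap (Tate P ρ) (Mer P ρ)).comp (algebraMap (AT P K) (Tate P ρ))).toAlgebra

instance (ρ : Radius L) : IsScalarTower (AT P K) (Tate P ρ) (Mer P ρ) :=
  .of_algebraMap_eq fun _ ↦ rfl

instance (ρ : Radius L) : Algebra (regularAway P) (Mer P ρ) :=
  ((algebraMap (AT P K) (Mer P ρ)).comp (algebraMap (regularAway P) (AT P K))).toAlgebra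

instance (ρ : Radius L) : IsScalarTower (regularAway P) (AT P K) (Mer P ρ) :=
  .of_algebraMap_eq fun _ ↦ rfl

instance (ρ : Radius L) : PolesInvertible P (Mer P ρ) where
  isUnit s hs := IsLocalization.map_units (Mer P ρ)
    (⟨_, Algebra.mem_algebraMapSubmonoid_of_mem ⟨s, hs⟩⟩ :
      Algebra.algebraMapSubmonoid (Tate P ρ) (poleSet P))

/-- The extension of `τ` to meromorphic functions on `𝔛_ρ`. -/
def Mer.tau (ρ : Radius L) : Mer P ρ →+* Mer P ρ :=
  IsLocalization.map (M := Algebra.algebraMapSubmonoid (Tate P ρ) (poleSet P))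
    (T := Algebra.algebraMapSubmonoid (Tate P ρ) (poleSet P)) (Mer P ρ) (Tate.tau ρ) (by
      rintro _ ⟨s, hs, rfl⟩
      exact ⟨_, tau_mem_poleSet P hs, (Tate.tau_algebraMap ρ s).symm⟩)

lemma Mer.tau_algebraMap (ρ : Radius L) (b : AT P K) :
    Mer.tau ρ (algebraMap (AT P K) (Mer P ρ) b) =
      algebraMap (AT P K) (Mer P ρ) (AMotive.tau P K b) := by
  rw [IsScalarTower.algebraMap_apply _ (Tate P ρ), Mer.tau, IsLocalization.map_eq,
    Tate.tau_algebraMap, ← IsScalarTower.algebraMap_apply]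

/-- The restriction of meromorphic functions from `𝔛_ρ'` to `𝔛_ρ`, for `ρ ≤ ρ'`. -/
def Mer.restrict {ρ ρ' : Radius L} (h : ρ ≤ ρ') : Mer P ρ' →ₐ[AT P K] Mer P ρ where
  toRingHom := IsLocalization.map (M := Algebra.algebraMapSubmonoid (Tate P ρ') (poleSet P))
    (T := Algebra.algebraMapSubmonoid (Tate P ρ) (poleSet P)) (Mer P ρ)
    (Tate.restrict (P := P) h).toRingHom (by
      rintro _ ⟨s, hs, rfl⟩
      exact ⟨s, hs, ((Tate.restrict (P := P) h).commutes s).symm⟩)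
  commutes' b := (IsLocalization.map_eq _ _).trans
    (congrArg (algebraMap (Tate P ρ) (Mer P ρ)) ((Tate.restrict h).commutes b))

/-- The sections over `𝔛_ρ` of the sheaf `𝒪(n · J) = colim_m 𝒪(n · J_m)`: those meromorphic
functions `f` with `I_m ^ n · f ⊆ L⟨A⟩_ρ` for some `m`, where `I_m` is the ideal of `J_m`. -/
def sectionsOn (n : ℕ) (ρ : Radius L) : Submodule (AT P K) (Mer P ρ) where
  carrier := {f | ∃ m : ℕ, ∀ g ∈ JIdeal P m ^ n, g • f ∈ (algebraMap (Tate P ρ) (Mer P ρ)).range}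
  zero_mem' := ⟨0, fun g _ ↦ by rw [smul_zero]; exact zero_mem _⟩
  add_mem' := by
    rintro x y ⟨m, hx⟩ ⟨m', hy⟩
    refine ⟨max m m', fun g hg ↦ ?_⟩
    rw [smul_add]
    exact add_mem (hx g (Ideal.pow_right_mono (JIdeal_anti P (le_max_left _ _)) n hg))
      (hy g (Ideal.pow_right_mono (JIdeal_anti P (le_max_right _ _)) n hg))
  smul_mem' b := by
    rintro x ⟨m, hx⟩
    refine ⟨m, fun g hg ↦ ?_⟩
    rw [smul_smul, mul_comm, mul_smul]
    obtain ⟨y, hy⟩ := hx g hg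
    exact ⟨algebraMap _ _ b * y, by rw [map_mul, hy, ← IsScalarTower.algebraMap_apply,
      Algebra.smul_def b]⟩

variable (P L) in
/-- The module `𝒪_𝔛(n · J)(𝔛_L)` of global sections on the rigid analytification
`𝔛_L = ⋃_ρ 𝔛_ρ` of `Spec (A ⊗ L)`: compatible families of sections over the `𝔛_ρ`. -/
def globalSections (n : ℕ) : Submodule (AT P K) (∀ ρ : Radius L, Mer P ρ) where
  carrier := {f | (∀ ρ, f ρ ∈ sectionsOn n ρ) ∧
    ∀ (ρ ρ' : Radius L) (h : ρ ≤ ρ'), Mer.restrict h (f ρ') = f ρ}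
  zero_mem' := ⟨fun _ ↦ zero_mem _, fun _ _ _ ↦ map_zero _⟩
  add_mem' hf hg := ⟨fun ρ ↦ add_mem (hf.1 ρ) (hg.1 ρ), fun ρ ρ' h ↦ by
    rw [Pi.add_apply, map_add, hf.2 ρ ρ' h, hg.2 ρ ρ' h]; rfl⟩
  smul_mem' b f hf := ⟨fun ρ ↦ Submodule.smul_mem _ b (hf.1 ρ), fun ρ ρ' h ↦ by
    rw [Pi.smul_apply, map_smul, hf.2 ρ ρ' h]; rfl⟩

/-- The value on `𝔛_ρ` of a global section of `𝒪_𝔛(n · J)`. -/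
def globalSections.eval (n : ℕ) (ρ : Radius L) : globalSections P L n →ₗ[AT P K] Mer P ρ :=
  (LinearMap.proj ρ).comp (globalSections P L n).subtype

/-- On `Sp L⟨A⟩ = 𝔛_1` all poles are invertible, so that `L⟨A⟩` is its own localization. -/
def tateEquivMer [IsNormedOver P L] : Tate P (1 : Radius L) ≃ₗ[AT P K] Mer P (1 : Radius L) :=
  ((IsLocalization.atUnits (Tate P (1 : Radius L))
    (Algebra.algebraMapSubmonoid (Tate P (1 : Radius L)) (poleSet P))
    (S := Mer P (1 : Radius L)) (by
      rintro _ ⟨s, hs, rfl⟩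
      exact PolesInvertible.isUnit s hs)).restrictScalars (AT P K)).toLinearEquiv

/-- The restriction map `𝒪_𝔛(n · J)(𝔛_L) → 𝒪_𝔛(n · J)(Sp L⟨A⟩) = L⟨A⟩`. -/
def globalSections.toTate [IsNormedOver P L] (n : ℕ) :
    globalSections P L n →ₗ[AT P K] Tate P (1 : Radius L) :=
  tateEquivMer.symm.toLinearMap.comp (globalSections.eval n 1)

section Motive

variable {M : Type*} [AddCommGroup M] [Module (AT P K) M] (T : MotiveStructure P M)

lemma MotiveStructure.act_smul {E : Type*} [CommRing E] [Algebra (AT P K) E]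
    (κ : jComplement P →ₐ[AT P K] E) (σ : E →+* E)
    (hσ : ∀ b, σ (algebraMap (AT P K) E b) = algebraMap (AT P K) E (tau P K b))
    (b : AT P K) (x : E ⊗[AT P K] M) :
    T.act κ σ hσ (b • x) = tau P K b • T.act κ σ hσ x := by
  induction x using TensorProduct.induction_on with
  | zero => simp
  | add x y hx hy => simp [hx, hy]
  | tmul e m =>
    rw [TensorProduct.smul_tmul']
    simp only [MotiveStructure.act, TensorProduct.liftAddHom_tmul, AddMonoidHom.coe_mk,
      ZeroHom.coe_mk, AddMonoidHom.comp_apply, DistribSMul.toAddMonoidHom_apply]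
    rw [Algebra.smul_def, map_mul, hσ, mul_smul, algebraMap_smul]

variable (P L) in
/-- The semilinear map `f ↦ τ_M(τ^* f)` on `L⟨A⟩ ⊗ M`. -/
def MotiveStructure.tateAct [IsNormedOver P L] :
    Tate P (1 : Radius L) ⊗[AT P K] M →+ Tate P (1 : Radius L) ⊗[AT P K] M :=
  T.act (kappa P _) (Tate.tau 1) (Tate.tau_algebraMap 1)

/-- The semilinear map `f ↦ τ_M(τ^* f)` on meromorphic functions on `𝔛_ρ` with values in `M`. -/
def MotiveStructure.merAct (ρ : Radius L) : Mer P ρ ⊗[AT P K] M →+ Mer P ρ ⊗[AT P K] M :=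
  T.act (kappa P _) (Mer.tau ρ) (Mer.tau_algebraMap ρ)

variable (L) in
/-- The `A`-module `(M ⊗ L⟨A⟩)^{τ_M = 1}`. -/
def MotiveStructure.tateFixed [IsNormedOver P L] :
    Submodule (regularAway P) (Tate P (1 : Radius L) ⊗[AT P K] M) where
  carrier := {x | T.tateAct P L x = x}
  zero_mem' := map_zero _
  add_mem' {x y} hx hy := by
    rw [Set.mem_ofPred_eq] at hx hy ⊢
    rw [map_add, hx, hy]
  smul_mem' a x hx := by
    rw [Set.mem_ofPred_eq] at hx ⊢
    rw [← algebraMap_smul (AT P K) a x, MotiveStructure.tateAct, MotiveStructure.act_smul,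
      AlgHom.commutes]
    exact congrArg _ hx

variable (L) in
/-- The `A`-module `(M ⊗ 𝒪_𝔛(n · J)(𝔛_L))^{τ_M = 1}`. The equation `τ_M(τ^* f) = f` is an equality
of meromorphic functions on `𝔛_L` with values in `M`, i.e. an equality on every `𝔛_ρ`. -/
def MotiveStructure.globalFixed (n : ℕ) :
    Submodule (regularAway P) (globalSections P L n ⊗[AT P K] M) where
  carrier := {x | ∀ ρ, T.merAct ρ ((globalSections.eval n ρ).rTensor M x) =
    (globalSections.eval n ρ).rTensor M x}
  zero_mem' := fun ρ ↦ by simp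
  add_mem' {x y} hx hy := fun ρ ↦ by rw [map_add, map_add, hx ρ, hy ρ]
  smul_mem' a x hx := fun ρ ↦ by
    rw [← algebraMap_smul (AT P K) a x, map_smul, MotiveStructure.merAct,
      MotiveStructure.act_smul, AlgHom.commutes]
    exact congrArg _ (hx ρ)

end Motive

end Analytic

section Betti

variable {F K : Type*} [Field F] [Fintype F] [Field K] [Algebra F K] {P : Place F K}
  [IsDiscreteValuationRing P.ring]

instance (L : IntermediateField (Kinf P) (Ksep P)) : IsNormedOver P L where
  one_lt_norm a ha := by
    have h1 := one_lt_norm_Kinf ha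
    have h2 : ‖algebraMap (Kinf P) (Ksep P) (algebraMap K (Kinf P) a)‖ = _ :=
      norm_algebraMap' (Ksep P) _
    rw [← h2] at h1
    exact h1

instance : IsNormedOver P (Cinf P) where
  one_lt_norm a ha := by
    have h1 := one_lt_norm_Kinf ha
    rw [← norm_algebraMap' (Ksep P), ← norm_algebraMap_Cinf] at h1
    exact h1

/-- The inclusion of a subextension `L` of `K_∞^s / K_∞` in `ℂ_∞`. -/
def inclCinf (L : IntermediateField (Kinf P) (Ksep P)) : L →ₐ[K] Cinf P :=
  (IsScalarTower.toAlgHom K (Ksep P) (Cinf P)).comp (L.val.restrictScalars K)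

/-- The inclusion `L⟨A⟩ → ℂ_∞⟨A⟩`. -/
def Tate.toCinf (L : IntermediateField (Kinf P) (Ksep P)) :
    Tate P (1 : Radius L) →ₐ[AT P K] Tate P (1 : Radius (Cinf P)) :=
  Tate.baseChange (inclCinf L) fun x ↦ norm_algebraMap_Cinf P (x : Ksep P)

variable {M : Type*} [AddCommGroup M] [Module (AT P K) M] (T : MotiveStructure P M)

/-- The Betti realization `M_B = {ω ∈ M ⊗ ℂ_∞⟨A⟩ | ω = τ_M(τ^* ω)}`. -/
def MotiveStructure.betti :
    Submodule (regularAway P) (Tate P (1 : Radius (Cinf P)) ⊗[AT P K] M) :=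
  T.tateFixed (Cinf P)

/-- Rigid analytic triviality: the multiplication map
`ℂ_∞⟨A⟩ ⊗_A M_B → M ⊗ ℂ_∞⟨A⟩` is bijective. -/
def MotiveStructure.IsRigidAnalyticallyTrivial : Prop :=
  Function.Bijective (T.betti.subtype.liftBaseChange (Tate P (1 : Radius (Cinf P))))

end Betti

end AMotive

end

/-!
Choose a basis of `A` adapted to the degree filtration, so that every element of `L⟨A⟩` has
coefficients in `L`. In coordinates a solution of `τ_M(τ^* f) = f` over `L⟨A⟩` satisfies
`f = Φ · τ(f)`, where `Φ` has poles in `n · 𝔧` only. It converges on a disc of radius `r > 1`: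
approximate it by a polynomial `u`, interpolate the smallness of `u - Φ · τ(u)` on the unit disc
with its boundedness on a larger one, and use that `Φ · τ(·)` contracts small vectors, so that its
iterates at `u` converge to `f` on a disc of radius greater than one.

The equation then propagates: `τ` turns a function on the disc of radius `r` with poles along `J_m`
into one on the disc of radius `r ^ q` with poles along `τ J_m`, and `Φ` adds poles along `𝔧`, where
`τ J_m + 𝔧 = J_{m+1}`. Hence `f` extends to all of `𝔛_L` with poles in `n · J`. Restriction to
`L⟨A⟩` is injective because it does not change the coefficients.
-/

noncomputable section

namespace AMotive

section Filtration

variable {F V : Type*} [DivisionRing F] [AddCommGroup V] [Module F V] {W : ℕ → Submodule F V}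

lemma exists_monotone_linearIndepOn_span_eq (hW : Monotone W) :
    ∃ t : ℕ → Set V, Monotone t ∧
      ∀ n, LinearIndepOn F id (t n) ∧ Submodule.span F (t n) = W n := by
  have extend (n : ℕ) (s : Set V) (hs : LinearIndepOn F id s) (hsW : s ⊆ W n) :
      ∃ t, s ⊆ t ∧ LinearIndepOn F id t ∧ Submodule.span F t = W n := by
    obtain ⟨t, htW, hst, hWt, ht⟩ := exists_linearIndepOn_id_extension hs hsW
    exact ⟨t, hst, ht, le_antisymm (Submodule.span_le.2 htW) hWt⟩
  have extend_succ (n : ℕ) (s : {s : Set V // LinearIndepOn F id s ∧ Submodule.span F s = W n}) :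
      ∃ t : {t : Set V // LinearIndepOn F id t ∧ Submodule.span F t = W (n + 1)},
        s.1 ⊆ t.1 := by
    obtain ⟨t, hst, ht⟩ := extend (n + 1) s s.2.1 <|
      Submodule.span_le.1 (s.2.2.le.trans (hW n.le_succ))
    exact ⟨⟨t, ht⟩, hst⟩
  choose next hnext using extend_succ
  obtain ⟨t₀, -, ht₀⟩ := extend 0 ∅ (linearIndepOn_empty F id) (Set.empty_subset _)
  let t (n : ℕ) : {s : Set V // LinearIndepOn F id s ∧ Submodule.span F s = W n} :=
    Nat.rec ⟨t₀, ht₀⟩ next n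
  exact ⟨fun n ↦ (t n).1, monotone_nat_of_le_succ fun n ↦ hnext n (t n), fun n ↦ (t n).2⟩

lemma exists_basis_adapted_to_filtration (hW : Monotone W) (hexhaust : ∀ v, ∃ n, v ∈ W n) :
    ∃ (s : Set V) (b : Module.Basis s F V),
      ∀ n, ∀ v ∈ W n, ∀ i, b.repr v i ≠ 0 → b i ∈ W n := by
  obtain ⟨t, hmono, ht⟩ := exists_monotone_linearIndepOn_span_eq hW
  have hli : LinearIndepOn F id (⋃ n, t n) :=
    linearIndepOn_iUnion_of_directed hmono.directed_le fun n ↦ (ht n).1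
  have hspan : ⊤ ≤ Submodule.span F (Set.range fun i : (⋃ n, t n) ↦ id (i : V)) := by
    intro v _
    obtain ⟨n, hn⟩ := hexhaust v
    rw [← (ht n).2] at hn
    refine Submodule.span_mono ?_ hn
    exact fun x hx ↦ ⟨⟨x, Set.mem_iUnion.2 ⟨n, hx⟩⟩, rfl⟩
  let b := Module.Basis.mk hli hspan
  have hb (i) : b i = i := Module.Basis.mk_apply ..
  refine ⟨_, b, fun n v hv i hi ↦ ?_⟩
  rw [← (ht n).2] at hv ⊢
  have hv' : v ∈ Submodule.span F (b '' {i | (i : V) ∈ t n}) := by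
    refine Submodule.span_mono ?_ hv
    exact fun x hx ↦ ⟨⟨x, Set.mem_iUnion.2 ⟨n, hx⟩⟩, hx, hb _⟩
  rw [Module.Basis.mem_span_image] at hv'
  rw [hb]
  exact Submodule.subset_span (hv' (Finsupp.mem_support_iff.2 hi))

end Filtration

section Degree

variable {F K : Type*} [Field F] [Field K] [Algebra F K] {P : Place F K}
  [IsDiscreteValuationRing P.ring]

lemma deg_le_deg_of_val_le {a b : K} (ha : a ≠ 0) (h : val P a ≤ val P b) :
    deg P a ≤ deg P b := by
  have ha' : val P a ≠ 0 := (Valuation.ne_zero_iff _).2 ha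
  have hb' : val P b ≠ 0 := fun hb ↦ ha' (le_zero_iff.1 (hb ▸ h))
  exact mul_le_mul_of_nonneg_left ((WithZero.log_le_log ha' hb').2 h) (by positivity)

lemma deg_add_le {a b : K} {n : ℤ} (hab : a + b ≠ 0) (ha : deg P a ≤ n) (hb : deg P b ≤ n) :
    deg P (a + b) ≤ n := by
  rcases le_max_iff.1 ((val P).map_add a b) with h | h
  · exact (deg_le_deg_of_val_le hab h).trans ha
  · exact (deg_le_deg_of_val_le hab h).trans hb

lemma deg_smul_le {c : F} {a : K} (h : c • a ≠ 0) : deg P (c • a) ≤ deg P a := by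
  refine deg_le_deg_of_val_le h ?_
  rw [Algebra.smul_def, map_mul]
  exact mul_le_of_le_one_left' (val_le_one_iff.2 (P.algebraMap_mem c))

variable (P) in
/-- The elements of `A` of degree at most `n`; the condition is imposed on nonzero elements only,
because of the junk value `deg P 0 = 0`. -/
def degLE (n : ℤ) : Submodule F (regularAway P) where
  carrier := {a | (a : K) ≠ 0 → deg P (a : K) ≤ n}
  zero_mem' h := absurd rfl h
  add_mem' {a b} ha hb hab := by
    rcases eq_or_ne (a : K) 0 with ha0 | ha0
    · simp only [AddMemClass.coe_add, ha0, zero_add] at hab ⊢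
      exact hb hab
    rcases eq_or_ne (b : K) 0 with hb0 | hb0
    · simp only [AddMemClass.coe_add, hb0, add_zero] at hab ⊢
      exact ha hab
    · exact deg_add_le hab (ha ha0) (hb hb0)
  smul_mem' c a ha hca :=
    (deg_smul_le hca).trans (ha fun ha0 ↦ hca (by simp [ha0]))

variable (P) in
lemma exists_basis_deg_le [Finite F] :
    ∃ (s : Set (regularAway P)) (b : Module.Basis s F (regularAway P)),
      ∀ a i, b.repr a i ≠ 0 → deg P (b i : K) ≤ deg P (a : K) := by
  cases nonempty_fintype F
  obtain ⟨s, b, hb⟩ := exists_basis_adapted_to_filtration (W := fun n : ℕ ↦ degLE P n)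
    (fun m n hmn a ha h ↦ (ha h).trans (by exact_mod_cast hmn))
    (fun a ↦ ⟨(deg P (a : K)).toNat, fun _ ↦ Int.self_le_toNat _⟩)
  refine ⟨s, b, fun a i hi ↦ ?_⟩
  have ha : (a : K) ≠ 0 := by
    intro ha
    obtain rfl : a = 0 := Subtype.ext ha
    simp at hi
  have hdeg := Int.toNat_of_nonneg (deg_nonneg a.2 ha)
  have hbi : (b i : K) ≠ 0 := fun h ↦ b.ne_zero i (Subtype.ext h)
  exact (hb _ a (fun _ ↦ hdeg.ge) i hi hbi).trans hdeg.le

end Degree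

section FiniteConstants

variable {F : Type*} [Field F] [Finite F] {L : Type*} [NormedField L] [Algebra F L]

lemma norm_algebraMap_le_one_of_finite (c : F) : ‖algebraMap F L c‖ ≤ 1 := by
  cases nonempty_fintype F
  have hq : ‖algebraMap F L c‖ ^ Fintype.card F = ‖algebraMap F L c‖ := by
    rw [← norm_pow, ← map_pow, FiniteField.pow_card]
  by_contra! h
  exact (lt_self_pow₀ h Fintype.one_lt_card).ne' hq

lemma isUltrametricDist_of_finite (F L : Type*) [Field F] [Finite F] [NormedField L]
    [Algebra F L] : IsUltrametricDist L := by
  refine IsUltrametricDist.isUltrametricDist_of_forall_norm_natCast_le_one fun n ↦ ?_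
  simpa only [map_natCast] using norm_algebraMap_le_one_of_finite (L := L) (n : F)

end FiniteConstants

section TensorBall

variable {F K : Type*} [Field F] [Field K] [Algebra F K] {P : Place F K}
  [IsDiscreteValuationRing P.ring]
variable {L : Type*} [NormedField L] [Algebra F L]

lemma Radius.coe_one : (1 : Radius L).1 = 1 := rfl

variable (P L) in
/-- The elements of `A ⊗ L` of norm at most `C` at the radius `r`: the finite sums of tensors
`a ⊗ ℓ` with `|ℓ| r ^ (deg a) ≤ C`. In contrast to `gaussBall`, the real radius `r` need not be
the absolute value of an element of `L`. -/
def tensorBall (r C : ℝ) : AddSubgroup (AT P L) :=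
  AddSubgroup.closure {f | ∃ (a : regularAway P) (l : L), a ≠ 0 ∧
    ‖l‖ * r ^ deg P (a : K) ≤ C ∧ f = AT.mk a l}

lemma mem_tensorBall_of_gaussNorm_lt {ρ : Radius L} {C : ℝ} {f : AT P L}
    (h : gaussNorm P ρ f < C) : f ∈ tensorBall P L ρ.1 C :=
  mem_gaussBall_of_lt h

lemma gaussNorm_le_of_mem_tensorBall {ρ : Radius L} {C : ℝ} (hC : 0 ≤ C) {f : AT P L}
    (h : f ∈ tensorBall P L ρ.1 C) : gaussNorm P ρ f ≤ C :=
  gaussNorm_le hC h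

lemma mem_tensorBall_one_of_gaussNorm_lt {C : ℝ} {f : AT P L}
    (h : gaussNorm P (1 : Radius L) f < C) : f ∈ tensorBall P L 1 C := by
  rw [← Radius.coe_one (L := L)]
  exact mem_tensorBall_of_gaussNorm_lt h

lemma gaussNorm_one_le_of_mem_tensorBall {C : ℝ} (hC : 0 ≤ C) {f : AT P L}
    (h : f ∈ tensorBall P L 1 C) : gaussNorm P (1 : Radius L) f ≤ C := by
  refine gaussNorm_le_of_mem_tensorBall hC ?_
  rwa [Radius.coe_one]

lemma mk_mem_tensorBall {a : regularAway P} {l : L} {r C : ℝ} (ha : a ≠ 0)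
    (h : ‖l‖ * r ^ deg P (a : K) ≤ C) : AT.mk a l ∈ tensorBall P L r C :=
  AddSubgroup.subset_closure ⟨a, l, ha, h, rfl⟩

lemma tensorBall_le_iff {r C : ℝ} {H : AddSubgroup (AT P L)} :
    tensorBall P L r C ≤ H ↔
      ∀ (a : regularAway P) (l : L), a ≠ 0 → ‖l‖ * r ^ deg P (a : K) ≤ C → AT.mk a l ∈ H := by
  refine (AddSubgroup.closure_le H).trans ⟨fun h a l ha hl ↦ h ⟨a, l, ha, hl, rfl⟩, ?_⟩
  rintro h _ ⟨a, l, ha, hl, rfl⟩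
  exact h a l ha hl

lemma tensorBall_mono (r : ℝ) : Monotone (tensorBall P L r) := fun _ _ hC ↦
  tensorBall_le_iff.2 fun _ _ ha hl ↦ mk_mem_tensorBall ha (hl.trans hC)

lemma tensorBall_anti_radius [Finite F] {r r' C : ℝ} (hr : 1 ≤ r) (h : r ≤ r') :
    tensorBall P L r' C ≤ tensorBall P L r C := by
  cases nonempty_fintype F
  refine tensorBall_le_iff.2 fun a l ha hl ↦ mk_mem_tensorBall ha (le_trans ?_ hl)
  lift deg P (a : K) to ℕ using deg_nonneg a.2 (by simpa using ha) with d
  simp only [zpow_natCast]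
  gcongr

lemma exists_mem_tensorBall {r : ℝ} (hr : 0 < r) (f : AT P L) :
    ∃ C, 0 ≤ C ∧ f ∈ tensorBall P L r C := by
  induction f using AT.induction with
  | zero => exact ⟨0, le_rfl, zero_mem _⟩
  | mk a c =>
    rcases eq_or_ne a 0 with rfl | ha
    · exact ⟨0, le_rfl, by rw [AT.zero_mk]; exact zero_mem _⟩
    · exact ⟨‖c‖ * r ^ deg P (a : K), by positivity, mk_mem_tensorBall ha le_rfl⟩
  | add x y hx hy =>
    obtain ⟨C, hC, hx⟩ := hx
    obtain ⟨D, -, hy⟩ := hy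
    exact ⟨max C D, hC.trans (le_max_left _ _), add_mem
      (tensorBall_mono r (le_max_left _ _) hx) (tensorBall_mono r (le_max_right _ _) hy)⟩

lemma mk_mul_mk_mem_tensorBall {r C D : ℝ} (hr : 0 < r) (hC : 0 ≤ C) {a b : regularAway P}
    {l m : L} (ha : a ≠ 0) (hl : ‖l‖ * r ^ deg P (a : K) ≤ C) (hb : b ≠ 0)
    (hm : ‖m‖ * r ^ deg P (b : K) ≤ D) : AT.mk a l * AT.mk b m ∈ tensorBall P L r (C * D) := by
  rw [AT.mk_mul]
  refine mk_mem_tensorBall (mul_ne_zero ha hb) ?_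
  rw [MulMemClass.coe_mul, deg_mul (by simpa using ha) (by simpa using hb),
    zpow_add₀ hr.ne', norm_mul, mul_mul_mul_comm]
  exact mul_le_mul hl hm (by positivity) hC

lemma mul_mem_tensorBall {r C D : ℝ} (hr : 0 < r) (hC : 0 ≤ C) {f g : AT P L}
    (hf : f ∈ tensorBall P L r C) (hg : g ∈ tensorBall P L r D) :
    f * g ∈ tensorBall P L r (C * D) := by
  suffices h : tensorBall P L r C ≤
      (tensorBall P L r (C * D)).comap (AddMonoidHom.mulRight g) from h hf
  refine tensorBall_le_iff.2 fun a l ha hl ↦ ?_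
  suffices h : tensorBall P L r D ≤
      (tensorBall P L r (C * D)).comap (AddMonoidHom.mulLeft (AT.mk a l)) from h hg
  exact tensorBall_le_iff.2 fun b m hb hm ↦ mk_mul_mk_mem_tensorBall hr hC ha hl hb hm

lemma tau_mem_tensorBall [Fintype F] {r C : ℝ} (hr : 0 < r) {f : AT P L}
    (hf : f ∈ tensorBall P L r C) :
    tau P L f ∈ tensorBall P L (r ^ Fintype.card F) (C ^ Fintype.card F) := by
  suffices h : tensorBall P L r C ≤ (tensorBall P L (r ^ Fintype.card F)
      (C ^ Fintype.card F)).comap (tau P L : AT P L →+ AT P L) from h hf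
  refine tensorBall_le_iff.2 fun a l ha hl ↦ ?_
  refine mk_mem_tensorBall (a := a) (l := l ^ Fintype.card F) ha ?_
  rw [norm_pow, ← zpow_natCast r, zpow_comm, zpow_natCast, ← mul_pow]
  gcongr

end TensorBall

section Coefficients

variable {F K : Type*} [Field F] [Finite F] [Field K] [Algebra F K] (P : Place F K)
  [IsDiscreteValuationRing P.ring]

/-- The underlying set of `degBasis`. -/
def degBasisSet : Set (regularAway P) := (exists_basis_deg_le P).choose

/-- A basis of `A` over `F` adapted to the filtration by the degree: the basis elements occurring
in `a` have degree at most `deg a`. The Gauss norms and the balls `tensorBall` are weighted maxima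
of the coordinates in this basis. -/
def degBasis : Module.Basis (degBasisSet P) F (regularAway P) :=
  (exists_basis_deg_le P).choose_spec.choose

variable {P}

lemma deg_degBasis_le {a : regularAway P} {i : degBasisSet P} (h : (degBasis P).repr a i ≠ 0) :
    deg P (degBasis P i : K) ≤ deg P (a : K) :=
  (exists_basis_deg_le P).choose_spec.choose_spec a i h

section AlgebraicCoefficients

variable {R S : Type*} [CommRing R] [Algebra F R] [CommRing S] [Algebra F S]

variable (P R) in
open scoped Classical in
/-- The coefficients of an element of `A ⊗ R` in the basis `degBasis` of `A`. -/
def coef : AT P R ≃+ (degBasisSet P →₀ R) :=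
  (TensorProduct.equivFinsuppOfBasisLeft (N := R) (degBasis P)).toAddEquiv

lemma coef_mk (a : regularAway P) (c : R) (i : degBasisSet P) :
    coef P R (AT.mk a c) i = (degBasis P).repr a i • c := by
  classical exact TensorProduct.equivFinsuppOfBasisLeft_apply_tmul_apply _ a c i

lemma sum_mk_degBasis_coef (f : AT P R) :
    ∑ i ∈ (coef P R f).support, AT.mk (degBasis P i) (coef P R f i) = f := by
  classical
  exact (TensorProduct.equivFinsuppOfBasisLeft_symm_apply (degBasis P) (coef P R f)).symm.trans
    ((coef P R).symm_apply_apply f)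

lemma coef_map (φ : R →ₐ[F] S) (f : AT P R) (i : degBasisSet P) :
    coef P S (AT.map P φ f) i = φ (coef P R f i) := by
  induction f using AT.induction with
  | zero => simp only [map_zero, Finsupp.zero_apply]
  | mk a c => rw [AT.map_mk, coef_mk, coef_mk, map_smul]
  | add x y hx hy => simp only [map_add, Finsupp.add_apply, hx, hy]

end AlgebraicCoefficients

variable {L : Type*} [NormedField L] [Algebra F L]

lemma norm_coef_mul_zpow_le {r C : ℝ} (hr : 1 ≤ r) (hC : 0 ≤ C) {f : AT P L}
    (hf : f ∈ tensorBall P L r C) (i : degBasisSet P) :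
    ‖coef P L f i‖ * r ^ deg P (degBasis P i : K) ≤ C := by
  have : 0 < r := by linarith
  have := isUltrametricDist_of_finite F L
  induction hf using AddSubgroup.closure_induction with
  | mem f hf =>
    obtain ⟨a, l, -, hl, rfl⟩ := hf
    rw [coef_mk]
    rcases eq_or_ne ((degBasis P).repr a i) 0 with h | h
    · simpa [h] using hC
    · refine le_trans (mul_le_mul ?_ (zpow_le_zpow_right₀ hr (deg_degBasis_le h))
        (by positivity) (norm_nonneg l)) hl
      rw [Algebra.smul_def, norm_mul]
      exact mul_le_of_le_one_left (norm_nonneg _) (norm_algebraMap_le_one_of_finite _)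
  | zero => simpa using hC
  | add x y _ _ hx hy =>
    rw [map_add, Finsupp.add_apply]
    refine le_trans ?_ (max_le hx hy)
    rw [← max_mul_of_nonneg _ _ (by positivity)]
    gcongr
    exact IsUltrametricDist.norm_add_le_max _ _
  | neg x _ hx => rwa [map_neg, Finsupp.neg_apply, norm_neg]

lemma mem_tensorBall_iff {r C : ℝ} (hr : 1 ≤ r) (hC : 0 ≤ C) {f : AT P L} :
    f ∈ tensorBall P L r C ↔ ∀ i, ‖coef P L f i‖ * r ^ deg P (degBasis P i : K) ≤ C := by
  refine ⟨norm_coef_mul_zpow_le hr hC, fun h ↦ ?_⟩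
  rw [← sum_mk_degBasis_coef f]
  exact sum_mem fun i _ ↦ mk_mem_tensorBall ((degBasis P).ne_zero i) (h i)

lemma mem_tensorBall_of_interpolate {r δ C ε : ℝ} {N : ℕ} (hr : 1 ≤ r) (hδ : 0 ≤ δ) (hC : 0 ≤ C)
    (hε : 0 ≤ ε) (hN : δ ^ N * C ≤ ε ^ (N + 1)) {f : AT P L} (h1 : f ∈ tensorBall P L 1 δ)
    (h2 : f ∈ tensorBall P L (r ^ (N + 1)) C) : f ∈ tensorBall P L r ε := by
  have : 0 < r := by linarith
  refine (mem_tensorBall_iff hr hε).2 fun i ↦ ?_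
  set d := deg P (degBasis P i : K)
  have norm_le : ‖coef P L f i‖ ≤ δ := by
    simpa only [one_zpow, mul_one] using (mem_tensorBall_iff le_rfl hδ).1 h1 i
  have norm_mul_le : ‖coef P L f i‖ * (r ^ d) ^ (N + 1) ≤ C := by
    simpa only [← zpow_natCast, zpow_comm r] using
      (mem_tensorBall_iff (one_le_pow₀ hr) hC).1 h2 i
  refine le_of_pow_le_pow_left₀ N.succ_ne_zero hε ?_
  calc (‖coef P L f i‖ * r ^ d) ^ (N + 1)
      = ‖coef P L f i‖ ^ N * (‖coef P L f i‖ * (r ^ d) ^ (N + 1)) := by ring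
    _ ≤ δ ^ N * C := by gcongr
    _ ≤ ε ^ (N + 1) := hN

lemma gaussNorm_le_iff {ρ : Radius L} {f : AT P L} {C : ℝ} (hC : 0 ≤ C) :
    gaussNorm P ρ f ≤ C ↔ ∀ i, ‖coef P L f i‖ * ρ.1 ^ deg P (degBasis P i : K) ≤ C := by
  have : 0 < ρ.1 := one_pos.trans_le ρ.2.1
  constructor
  · refine fun h i ↦ le_of_forall_pos_le_add fun ε hε ↦ ?_
    exact norm_coef_mul_zpow_le ρ.2.1 (by positivity)
      (mem_tensorBall_of_gaussNorm_lt (h.trans_lt (lt_add_of_pos_right C hε))) i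
  · exact fun h ↦ gaussNorm_le_of_mem_tensorBall hC ((mem_tensorBall_iff ρ.2.1 hC).2 h)

lemma gaussNorm_map {L' : Type*} [NormedField L'] [Algebra F L'] (f : L →ₐ[F] L')
    (hf : ∀ x, ‖f x‖ = ‖x‖) (x : AT P L) :
    gaussNorm P (1 : Radius L') (AT.map P f x) = gaussNorm P (1 : Radius L) x := by
  refine eq_of_forall_ge_iff fun C ↦ ?_
  rcases lt_or_ge C 0 with hC | hC
  · simp only [(hC.trans_le (gaussNorm_nonneg _ _)).not_ge]
  · rw [gaussNorm_le_iff hC, gaussNorm_le_iff hC]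
    simp only [coef_map, hf]
    rfl

end Coefficients

section TateAlgebra

variable {F K : Type*} [Field F] [Field K] [Algebra F K] {P : Place F K}
  [IsDiscreteValuationRing P.ring]
variable {L : Type*} [NormedField L] [Algebra F L]

lemma Radius.one_le (ρ : Radius L) : (1 : Radius L) ≤ ρ := ρ.2.1

lemma Tate.denseRange_of (ρ : Radius L) : DenseRange (Tate.of (P := P) ρ) :=
  UniformSpace.Completion.denseRange_coe (α := GaussRing P ρ)

@[elab_as_elim]
lemma Tate.induction_on {ρ : Radius L} {p : Tate P ρ → Prop} (x : Tate P ρ)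
    (isClosed : IsClosed {x | p x}) (of : ∀ f, p (Tate.of ρ f)) : p x :=
  (Tate.denseRange_of ρ).induction_on x isClosed of

section Coefficients

variable [Finite F]

/-- The coefficient homomorphism `f ↦ coef P L f i` on `A ⊗ L` with the Gauss norm. -/
def GaussRing.coef (ρ : Radius L) (i : degBasisSet P) : GaussRing P ρ →+ L :=
  (Finsupp.applyAddHom i).comp
    ((AMotive.coef P L).toAddMonoidHom.comp (GaussRing.equiv ρ).symm.toAddMonoidHom)

lemma GaussRing.norm_coef_mul_zpow_le {ρ : Radius L} (i : degBasisSet P) (f : GaussRing P ρ) :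
    ‖GaussRing.coef ρ i f‖ * ρ.1 ^ deg P (degBasis P i : K) ≤ ‖f‖ :=
  (gaussNorm_le_iff (norm_nonneg f)).1 le_rfl i

lemma GaussRing.continuous_coef (ρ : Radius L) (i : degBasisSet P) :
    Continuous (GaussRing.coef ρ i) := by
  have : 0 < ρ.1 := one_pos.trans_le ρ.2.1
  refine AddMonoidHomClass.continuous_of_bound _ (ρ.1 ^ deg P (degBasis P i : K))⁻¹ fun f ↦ ?_
  rw [inv_mul_eq_div, le_div_iff₀ (by positivity)]
  exact norm_coef_mul_zpow_le i f

/-- The `i`-th coefficient of an element of `L⟨A⟩_ρ` in the basis `degBasis` of `A`, an element of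
the completion of `L`. -/
def Tate.coef (ρ : Radius L) (i : degBasisSet P) : Tate P ρ →+ UniformSpace.Completion L :=
  (GaussRing.coef ρ i).completion (GaussRing.continuous_coef ρ i)

lemma Tate.continuous_coef (ρ : Radius L) (i : degBasisSet P) : Continuous (Tate.coef ρ i) :=
  (GaussRing.coef ρ i).continuous_completion (GaussRing.continuous_coef ρ i)

lemma Tate.coef_of (ρ : Radius L) (i : degBasisSet P) (f : AT P L) :
    Tate.coef ρ i (Tate.of ρ f) = (AMotive.coef P L f i : UniformSpace.Completion L) :=
  (GaussRing.coef ρ i).completion_coe (GaussRing.continuous_coef ρ i) _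

lemma Tate.norm_coef_mul_zpow_le {ρ : Radius L} (i : degBasisSet P) (x : Tate P ρ) :
    ‖Tate.coef ρ i x‖ * ρ.1 ^ deg P (degBasis P i : K) ≤ ‖x‖ := by
  induction x using Tate.induction_on with
  | isClosed =>
    exact isClosed_le ((continuous_coef ρ i).norm.mul continuous_const) continuous_norm
  | of f =>
    rw [coef_of, UniformSpace.Completion.norm_coe, norm_tate_of]
    exact (gaussNorm_le_iff (gaussNorm_nonneg ρ f)).1 le_rfl i

lemma Tate.eq_zero_of_coef_eq_zero {ρ : Radius L} {x : Tate P ρ} (h : ∀ i, Tate.coef ρ i x = 0) :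
    x = 0 := by
  refine norm_le_zero_iff.1 (le_of_forall_pos_le_add fun ε hε ↦ ?_)
  obtain ⟨f, hf⟩ := Metric.denseRange_iff.1 (Tate.denseRange_of ρ) x (ε / 2) (half_pos hε)
  rw [dist_eq_norm] at hf
  have norm_of_le : ‖Tate.of ρ f‖ ≤ ε / 2 := by
    rw [norm_tate_of, gaussNorm_le_iff (half_pos hε).le]
    intro i
    have hcoef : ‖AMotive.coef P L f i‖ = ‖Tate.coef ρ i (x - Tate.of ρ f)‖ := by
      rw [map_sub, h i, zero_sub, norm_neg, coef_of, UniformSpace.Completion.norm_coe]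
    rw [hcoef]
    exact (norm_coef_mul_zpow_le i _).trans hf.le
  calc ‖x‖ ≤ ‖x - Tate.of ρ f‖ + ‖Tate.of ρ f‖ := norm_le_norm_sub_add _ _
    _ ≤ 0 + ε := by linarith

end Coefficients

lemma Tate.continuous_map {L' : Type*} [NormedField L'] [Algebra F L'] {ρ : Radius L}
    {ρ' : Radius L'} (φ : AT P L →+* AT P L') (h : Continuous (GaussRing.hom ρ ρ' φ)) :
    Continuous (Tate.map φ h) :=
  UniformSpace.Completion.continuous_map

variable [Fintype F]

lemma Tate.continuous_tau (ρ : Radius L) : Continuous (Tate.tau (P := P) ρ) :=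
  continuous_map _ (AMotive.continuous_tau ρ)

lemma Tate.tau_of (ρ : Radius L) (f : AT P L) :
    Tate.tau ρ (Tate.of ρ f) = Tate.of ρ (AMotive.tau P L f) :=
  map_of _ (AMotive.continuous_tau ρ) f

variable [Algebra K L] [IsScalarTower F K L]

lemma Tate.continuous_restrict {ρ ρ' : Radius L} (h : ρ ≤ ρ') :
    Continuous (Tate.restrict (P := P) h) :=
  continuous_map _ (continuous_id_gauss h)

lemma Tate.restrict_of {ρ ρ' : Radius L} (h : ρ ≤ ρ') (f : AT P L) :
    Tate.restrict h (Tate.of ρ' f) = Tate.of ρ f :=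
  map_of _ (continuous_id_gauss h) f

lemma Tate.restrict_restrict {ρ ρ' ρ'' : Radius L} (h : ρ ≤ ρ') (h' : ρ' ≤ ρ'') (h'' : ρ ≤ ρ'')
    (x : Tate P ρ'') : Tate.restrict h (Tate.restrict h' x) = Tate.restrict h'' x := by
  induction x using Tate.induction_on with
  | isClosed =>
    exact isClosed_eq ((continuous_restrict h).comp (continuous_restrict h'))
      (continuous_restrict h'')
  | of f => simp only [restrict_of]

lemma Tate.coef_restrict {ρ ρ' : Radius L} (h : ρ ≤ ρ') (i : degBasisSet P) (x : Tate P ρ') :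
    Tate.coef ρ i (Tate.restrict h x) = Tate.coef ρ' i x := by
  induction x using Tate.induction_on with
  | isClosed =>
    exact isClosed_eq ((continuous_coef ρ i).comp (continuous_restrict h)) (continuous_coef ρ' i)
  | of f => rw [restrict_of, coef_of, coef_of]

lemma Tate.restrict_injective {ρ ρ' : Radius L} (h : ρ ≤ ρ') :
    Function.Injective (Tate.restrict (P := P) h) := by
  refine (injective_iff_map_eq_zero _).2 fun x hx ↦ eq_zero_of_coef_eq_zero fun i ↦ ?_
  rw [← coef_restrict h, hx, map_zero]

lemma Tate.continuous_baseChange {L' : Type*} [NormedField L'] [Algebra F L'] [Algebra K L']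
    [IsScalarTower F K L'] (f : L →ₐ[K] L') (hf : ∀ x, ‖f x‖ = ‖x‖) :
    Continuous (Tate.baseChange (P := P) f hf) :=
  continuous_map _ (AMotive.continuous_baseChange (f.restrictScalars F) hf)

lemma Tate.baseChange_of {L' : Type*} [NormedField L'] [Algebra F L'] [Algebra K L']
    [IsScalarTower F K L'] (f : L →ₐ[K] L') (hf : ∀ x, ‖f x‖ = ‖x‖) (y : AT P L) :
    Tate.baseChange f hf (Tate.of 1 y) = Tate.of 1 (AT.map P (f.restrictScalars F) y) :=
  map_of _ (AMotive.continuous_baseChange (f.restrictScalars F) hf) y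

lemma Tate.norm_baseChange {L' : Type*} [NormedField L'] [Algebra F L'] [Algebra K L']
    [IsScalarTower F K L'] (f : L →ₐ[K] L') (hf : ∀ x, ‖f x‖ = ‖x‖)
    (x : Tate P (1 : Radius L)) : ‖Tate.baseChange f hf x‖ = ‖x‖ := by
  induction x using Tate.induction_on with
  | isClosed => exact isClosed_eq (continuous_baseChange f hf).norm continuous_norm
  | of y => rw [baseChange_of, norm_tate_of, norm_tate_of, gaussNorm_map (f.restrictScalars F) hf]

lemma Tate.baseChange_injective {L' : Type*} [NormedField L'] [Algebra F L'] [Algebra K L']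
    [IsScalarTower F K L'] (f : L →ₐ[K] L') (hf : ∀ x, ‖f x‖ = ‖x‖) :
    Function.Injective (Tate.baseChange (P := P) f hf) :=
  (AddMonoidHomClass.isometry_of_norm _ (norm_baseChange f hf)).injective

lemma Tate.restrict_tau {ρ ρ' : Radius L} (h : ρ ≤ ρ') (x : Tate P ρ') :
    Tate.restrict h (Tate.tau ρ' x) = Tate.tau ρ (Tate.restrict h x) := by
  induction x using Tate.induction_on with
  | isClosed =>
    exact isClosed_eq ((continuous_restrict h).comp (continuous_tau ρ'))
      ((continuous_tau ρ).comp (continuous_restrict h))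
  | of f => simp only [tau_of, restrict_of]

lemma Tate.baseChange_tau {L' : Type*} [NormedField L'] [Algebra F L'] [Algebra K L']
    [IsScalarTower F K L'] (f : L →ₐ[K] L') (hf : ∀ x, ‖f x‖ = ‖x‖) (x : Tate P (1 : Radius L)) :
    Tate.baseChange f hf (Tate.tau 1 x) = Tate.tau 1 (Tate.baseChange f hf x) := by
  induction x using Tate.induction_on with
  | isClosed =>
    exact isClosed_eq ((continuous_baseChange f hf).comp (continuous_tau 1))
      ((continuous_tau 1).comp (continuous_baseChange f hf))
  | of y => simp only [tau_of, baseChange_of, map_tau]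

end TateAlgebra

lemma exists_one_lt_pow_le {c : ℝ} (hc : 1 < c) (d : ℕ) : ∃ r : ℝ, 1 < r ∧ r ^ d ≤ c := by
  have hlim : ∀ᶠ r : ℝ in nhdsWithin 1 (Set.Ioi 1), r ^ d ≤ c :=
    (((continuous_pow d).tendsto' 1 1 (one_pow d)).mono_left nhdsWithin_le_nhds).eventually_le_const
      hc
  exact (eventually_mem_nhdsWithin.and hlim).exists

section TateBall

variable {F K : Type*} [Field F] [Field K] [Algebra F K] {P : Place F K}
  [IsDiscreteValuationRing P.ring]
variable {L : Type*} [NormedField L] [Algebra F L]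

lemma one_mem_tensorBall (r : ℝ) : (1 : AT P L) ∈ tensorBall P L r 1 := by
  rw [AT.one_def]
  refine mk_mem_tensorBall one_ne_zero (le_of_eq ?_)
  rw [OneMemClass.coe_one, deg_one, zpow_zero, norm_one, mul_one]

variable (P L) in
/-- The elements of `L⟨A⟩` which are limits of elements of `tensorBall P L r C`. For `r > 1` these
are the functions on `𝔛_1` which extend to functions bounded by `C` on all spaces of radius less
than `r`. -/
def tateBall (r C : ℝ) : AddSubgroup (Tate P (1 : Radius L)) :=
  ((tensorBall P L r C).map (Tate.of (1 : Radius L)).toAddMonoidHom).topologicalClosure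

lemma isClosed_tateBall (r C : ℝ) : IsClosed (tateBall P L r C : Set (Tate P (1 : Radius L))) :=
  AddSubgroup.isClosed_topologicalClosure _

lemma of_mem_tateBall {r C : ℝ} {f : AT P L} (hf : f ∈ tensorBall P L r C) :
    Tate.of 1 f ∈ tateBall P L r C :=
  AddSubgroup.le_topologicalClosure _ ⟨f, hf, rfl⟩

lemma exists_of_mem_tateBall {r : ℝ} (hr : 0 < r) (f : AT P L) :
    ∃ C, 0 ≤ C ∧ Tate.of 1 f ∈ tateBall P L r C :=
  let ⟨C, hC, hf⟩ := exists_mem_tensorBall hr f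
  ⟨C, hC, of_mem_tateBall hf⟩

lemma one_mem_tateBall (r : ℝ) : (1 : Tate P (1 : Radius L)) ∈ tateBall P L r 1 := by
  simpa only [map_one] using of_mem_tateBall (one_mem_tensorBall (P := P) (L := L) r)

lemma tateBall_mono (r : ℝ) : Monotone (tateBall P L r) := fun _ _ h ↦
  closure_mono (AddSubgroup.map_mono (tensorBall_mono r h))

lemma tateBall_anti_radius [Finite F] {r r' C : ℝ} (hr : 1 ≤ r) (h : r ≤ r') :
    tateBall P L r' C ≤ tateBall P L r C :=
  closure_mono (AddSubgroup.map_mono (tensorBall_anti_radius hr h))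

lemma norm_le_of_mem_tateBall [Finite F] {r C : ℝ} (hr : 1 ≤ r) (hC : 0 ≤ C)
    {x : Tate P (1 : Radius L)} (hx : x ∈ tateBall P L r C) : ‖x‖ ≤ C := by
  refine closure_minimal ?_ (isClosed_le continuous_norm continuous_const)
    (tateBall_anti_radius le_rfl hr hx)
  rintro _ ⟨f, hf, rfl⟩
  exact (norm_tate_of 1 f).trans_le (gaussNorm_one_le_of_mem_tensorBall hC hf)

lemma mul_mem_tateBall {r C D : ℝ} (hr : 0 < r) (hC : 0 ≤ C) {x y : Tate P (1 : Radius L)}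
    (hx : x ∈ tateBall P L r C) (hy : y ∈ tateBall P L r D) : x * y ∈ tateBall P L r (C * D) := by
  refine map_mem_closure₂ continuous_mul hx hy ?_
  rintro _ ⟨f, hf, rfl⟩ _ ⟨g, hg, rfl⟩
  exact ⟨f * g, mul_mem_tensorBall hr hC hf hg, map_mul (Tate.of 1) f g⟩

lemma pow_mem_tateBall {r : ℝ} (hr : 0 < r) {x : Tate P (1 : Radius L)}
    (hx : x ∈ tateBall P L r 1) (n : ℕ) : x ^ n ∈ tateBall P L r 1 := by
  induction n with
  | zero => simpa only [pow_zero] using one_mem_tateBall r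
  | succ n ih => simpa only [pow_succ, mul_one] using mul_mem_tateBall hr zero_le_one ih hx

lemma exists_one_sub_mul_eq_one {r : ℝ} (hr : 0 < r) {z : Tate P (1 : Radius L)}
    (hz : z ∈ tateBall P L r 1) (hz1 : ‖z‖ < 1) : ∃ y ∈ tateBall P L r 1, (1 - z) * y = 1 :=
  ⟨∑' n : ℕ, z ^ n, (isClosed_tateBall r 1).mem_of_tendsto
    (summable_geometric_of_norm_lt_one hz1).hasSum.tendsto_sum_nat
    (.of_forall fun _ ↦ sum_mem fun i _ ↦ pow_mem_tateBall hr hz i), mul_neg_geom_series z hz1⟩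

lemma tau_mem_tateBall [Fintype F] {r C : ℝ} (hr : 0 < r) {x : Tate P (1 : Radius L)}
    (hx : x ∈ tateBall P L r C) :
    Tate.tau 1 x ∈ tateBall P L (r ^ Fintype.card F) (C ^ Fintype.card F) := by
  refine map_mem_closure (Tate.continuous_tau 1) hx ?_
  rintro _ ⟨f, hf, rfl⟩
  exact ⟨_, tau_mem_tensorBall hr hf, (Tate.tau_of 1 f).symm⟩

lemma mem_closure_of_image_inter_of_norm_lt {s : Set (AT P L)} {δ : ℝ}
    {x : Tate P (1 : Radius L)} (hx : x ∈ closure (Tate.of 1 '' s)) (hδ : ‖x‖ < δ) :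
    x ∈ closure (Tate.of 1 '' (s ∩ tensorBall P L 1 δ)) := by
  have hx' := Metric.isOpen_ball.inter_closure ⟨mem_ball_zero_iff.2 hδ, hx⟩
  refine closure_mono ?_ hx'
  rintro _ ⟨hf, f, hfs, rfl⟩
  rw [mem_ball_zero_iff, norm_tate_of] at hf
  exact ⟨f, ⟨hfs, mem_tensorBall_one_of_gaussNorm_lt hf⟩, rfl⟩

lemma mem_tateBall_one_of_norm_lt {δ : ℝ} {x : Tate P (1 : Radius L)} (hx : ‖x‖ < δ) :
    x ∈ tateBall P L 1 δ := by
  have hx' : x ∈ closure (Tate.of (1 : Radius L) '' Set.univ) := by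
    rw [Set.image_univ]
    exact Tate.denseRange_of 1 x
  have := mem_closure_of_image_inter_of_norm_lt hx' hx
  rwa [Set.univ_inter] at this

variable [Finite F]

lemma mem_tateBall_of_interpolate {r δ C ε : ℝ} {N : ℕ} (hr : 1 ≤ r) (hC : 0 ≤ C)
    (hε : 0 ≤ ε) (hN : δ ^ N * C ≤ ε ^ (N + 1)) {x : Tate P (1 : Radius L)} (h1 : ‖x‖ < δ)
    (h2 : x ∈ tateBall P L (r ^ (N + 1)) C) : x ∈ tateBall P L r ε := by
  refine closure_mono (Set.image_mono ?_) (mem_closure_of_image_inter_of_norm_lt h2 h1)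
  exact fun f hf ↦ mem_tensorBall_of_interpolate hr ((norm_nonneg x).trans h1.le) hC hε hN
    hf.2 hf.1

lemma cauchySeq_of_of_mem_tensorBall {ρ : Radius L} {C : ℝ} (hC : 0 ≤ C) {f : ℕ → AT P L}
    (hf : ∀ n, f n ∈ tensorBall P L (ρ.1 ^ 2) C)
    (hcau : CauchySeq fun n ↦ Tate.of (1 : Radius L) (f n)) :
    CauchySeq fun n ↦ Tate.of ρ (f n) := by
  refine Metric.cauchySeq_iff.2 fun ε hε ↦ ?_
  set δ := (ε / 2) ^ 2 / (C + 1) with hδ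
  have δ_mul_le : δ ^ 1 * C ≤ (ε / 2) ^ 2 := by
    rw [pow_one, hδ, div_mul_eq_mul_div, div_le_iff₀ (by positivity)]
    gcongr
    exact le_add_of_nonneg_right zero_le_one
  obtain ⟨N, hN⟩ := Metric.cauchySeq_iff.1 hcau δ (by positivity)
  refine ⟨N, fun m hm n hn ↦ ?_⟩
  have norm_lt := hN m hm n hn
  rw [dist_eq_norm, ← map_sub, norm_tate_of] at norm_lt ⊢
  have mem_ball : f m - f n ∈ tensorBall P L ρ.1 (ε / 2) :=
    mem_tensorBall_of_interpolate ρ.2.1 (by positivity) hC (by positivity) δ_mul_le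
      (mem_tensorBall_one_of_gaussNorm_lt norm_lt) (sub_mem (hf m) (hf n))
  exact (gaussNorm_le_of_mem_tensorBall (by positivity) mem_ball).trans_lt (half_lt_self hε)

end TateBall

section StructureMap

variable {F K : Type*} [Field F] [Fintype F] [Field K] [Algebra F K] {P : Place F K}

lemma kappa_comp {E E' : Type*} [CommRing E] [Algebra (AT P K) E] [PolesInvertible P E]
    [CommRing E'] [Algebra (AT P K) E'] [PolesInvertible P E'] (g : E →ₐ[AT P K] E') :
    g.comp (kappa P E) = kappa P E' := by
  rw [kappa, kappa, ← AlgHom.comp_assoc]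
  congr 1
  exact IsLocalization.algHom_ext (poleSet P) (Subsingleton.elim _ _)

end StructureMap

section Overconvergent

variable {F K : Type*} [Field F] [Field K] [Algebra F K] {P : Place F K}
  [IsDiscreteValuationRing P.ring]
variable {L : Type*} [NormedField L] [Algebra F L] [Algebra K L] [IsScalarTower F K L]

variable (P L) in
/-- The elements of `L⟨A⟩` which are bounded on the space of radius `r`, that is, which belong to
`tateBall P L r C` for some `C`. -/
def boundedOn (r : ℝ) (hr : 0 < r) : Subalgebra (AT P K) (Tate P (1 : Radius L)) where
  carrier := {x | ∃ C, 0 ≤ C ∧ x ∈ tateBall P L r C}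
  mul_mem' := by
    rintro x y ⟨C, hC, hx⟩ ⟨D, hD, hy⟩
    exact ⟨C * D, by positivity, mul_mem_tateBall hr hC hx hy⟩
  add_mem' := by
    rintro x y ⟨C, hC, hx⟩ ⟨D, -, hy⟩
    exact ⟨max C D, hC.trans (le_max_left _ _), add_mem (tateBall_mono r (le_max_left _ _) hx)
      (tateBall_mono r (le_max_right _ _) hy)⟩
  algebraMap_mem' b := exists_of_mem_tateBall hr _

lemma algebraMap_mk_sub_mk (a : regularAway P) {b : K} (hb : b ≠ 0) :
    algebraMap (AT P K) (Tate P (1 : Radius L)) (AT.mk a 1 - AT.mk 1 b) =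
      -(Tate.of 1 (AT.mk 1 (algebraMap K L b)) *
        (1 - Tate.of 1 (AT.mk a (algebraMap K L b)⁻¹))) := by
  change Tate.of 1 (AT.map P (IsScalarTower.toAlgHom F K L) _) = _
  rw [mul_sub, mul_one, ← map_mul, AT.mk_mul, one_mul,
    mul_inv_cancel₀ ((map_ne_zero (algebraMap K L)).2 hb), ← map_sub, ← map_neg, map_sub,
    AT.map_mk, AT.map_mk, map_one, neg_sub, IsScalarTower.coe_toAlgHom']

variable [Finite F]

lemma boundedOn_anti {r r' : ℝ} (hr : 1 ≤ r) (h : r ≤ r') (hr₀ : 0 < r) (hr'₀ : 0 < r') :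
    boundedOn P L r' hr'₀ ≤ boundedOn P L r hr₀ := fun _ ⟨C, hC, hx⟩ ↦
  ⟨C, hC, tateBall_anti_radius hr h hx⟩

variable (P L) in
/-- The overconvergent elements of `L⟨A⟩`: those which are bounded on some space of radius greater
than one. -/
def overconvergent : Subalgebra (AT P K) (Tate P (1 : Radius L)) where
  carrier := {x | ∃ (r : ℝ) (hr : 1 < r), x ∈ boundedOn P L r (one_pos.trans hr)}
  mul_mem' := by
    rintro x y ⟨r, hr, hx⟩ ⟨s, hs, hy⟩
    have h : 1 < min r s := lt_min hr hs
    exact ⟨min r s, h, mul_mem (boundedOn_anti h.le (min_le_left _ _) _ _ hx)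
      (boundedOn_anti h.le (min_le_right _ _) _ _ hy)⟩
  add_mem' := by
    rintro x y ⟨r, hr, hx⟩ ⟨s, hs, hy⟩
    have h : 1 < min r s := lt_min hr hs
    exact ⟨min r s, h, add_mem (boundedOn_anti h.le (min_le_left _ _) _ _ hx)
      (boundedOn_anti h.le (min_le_right _ _) _ _ hy)⟩
  algebraMap_mem' b := ⟨2, one_lt_two, Subalgebra.algebraMap_mem _ b⟩

lemma of_mem_overconvergent (f : AT P L) : Tate.of 1 f ∈ overconvergent P L :=
  ⟨2, one_lt_two, exists_of_mem_tateBall two_pos f⟩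

lemma isUnit_overconvergent_mk_sub_mk {a : regularAway P} (ha : a ≠ 0) {b : K}
    (hb : 1 < ‖algebraMap K L b‖) :
    IsUnit (algebraMap (AT P K) (overconvergent P L) (AT.mk a 1 - AT.mk 1 b)) := by
  cases nonempty_fintype F
  set c := algebraMap K L b with hc
  have hc0 : c ≠ 0 := norm_pos_iff.1 (one_pos.trans hb)
  obtain ⟨r, hr, hrc⟩ := exists_one_lt_pow_le hb (deg P (a : K)).toNat
  rw [← zpow_natCast, Int.toNat_of_nonneg (deg_nonneg a.2 (by simpa using ha))] at hrc
  set z : Tate P (1 : Radius L) := Tate.of 1 (AT.mk a c⁻¹) with hz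
  have z_mem : z ∈ tateBall P L r 1 := of_mem_tateBall <| mk_mem_tensorBall ha <| by
    rw [norm_inv, inv_mul_le_one₀ (one_pos.trans hb)]
    exact hrc
  have norm_z_lt : ‖z‖ < 1 := by
    refine (norm_tate_of 1 _).trans_lt
      ((gaussNorm_one_le_of_mem_tensorBall (norm_nonneg c⁻¹) ?_).trans_lt ?_)
    · exact mk_mem_tensorBall ha (by rw [one_zpow, mul_one])
    · rw [norm_inv]
      exact inv_lt_one_of_one_lt₀ hb
  obtain ⟨y, hy, hzy⟩ := exists_one_sub_mul_eq_one (one_pos.trans hr) z_mem norm_z_lt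
  have y_mem : y ∈ overconvergent P L := ⟨r, hr, 1, zero_le_one, hy⟩
  have of_mul_of : Tate.of (1 : Radius L) (AT.mk (1 : regularAway P) c) *
      Tate.of 1 (AT.mk 1 c⁻¹) = 1 := by
    rw [← map_mul, AT.mk_mul, mul_inv_cancel₀ hc0, one_mul, ← AT.one_def, map_one]
  refine IsUnit.of_mul_eq_one ⟨_, neg_mem (mul_mem (of_mem_overconvergent (AT.mk 1 c⁻¹)) y_mem)⟩
    (Subtype.ext ?_)
  change algebraMap (AT P K) (Tate P (1 : Radius L)) _ * _ = 1
  rw [algebraMap_mk_sub_mk a ((map_ne_zero _).1 hc0), ← hc, ← hz]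
  linear_combination (1 - z) * y * of_mul_of + hzy

end Overconvergent

section Frobenius

variable {F K : Type*} [Field F] [Fintype F] [Field K] [Algebra F K] {P : Place F K}
  [IsDiscreteValuationRing P.ring]
variable {L : Type*} [NormedField L] [Algebra F L] [Algebra K L] [IsScalarTower F K L]

lemma exists_restrict_eq_of_mem_tateBall (ρ : Radius L) {r C : ℝ} (hr : ρ.1 ^ 2 ≤ r)
    (hC : 0 ≤ C) {x : Tate P (1 : Radius L)} (hx : x ∈ tateBall P L r C) :
    ∃ y, Tate.restrict ρ.one_le y = x := by
  obtain ⟨u, hu, hux⟩ := mem_closure_iff_seq_limit.1 <|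
    tateBall_anti_radius (one_le_pow₀ ρ.2.1) hr hx
  choose f hf hfu using hu
  obtain rfl : (fun n ↦ Tate.of 1 (f n)) = u := funext hfu
  obtain ⟨y, hy⟩ := cauchySeq_tendsto_of_complete
    (cauchySeq_of_of_mem_tensorBall hC hf hux.cauchySeq)
  refine ⟨y, tendsto_nhds_unique ?_ hux⟩
  simpa only [Function.comp_def, Tate.restrict_of] using
    ((Tate.continuous_restrict ρ.one_le).tendsto y).comp hy

lemma tau_mem_boundedOn {r : ℝ} {hr : 0 < r} {x : Tate P (1 : Radius L)}
    (hx : x ∈ boundedOn P L r hr) :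
    Tate.tau 1 x ∈ boundedOn P L (r ^ Fintype.card F) (pow_pos hr _) :=
  let ⟨C, hC, hx⟩ := hx
  ⟨C ^ Fintype.card F, by positivity, tau_mem_tateBall hr hx⟩

instance [IsNormedOver P L] : PolesInvertible P (overconvergent P L) where
  isUnit s hs := by
    suffices h : poleSet P ≤ (IsUnit.submonoid (overconvergent P L)).comap
        (algebraMap (AT P K) (overconvergent P L)) from h hs
    refine Submonoid.closure_le.2 ?_
    rintro _ ⟨a, ha, i, rfl⟩
    refine isUnit_overconvergent_mk_sub_mk (by rintro rfl; exact ha (zero_mem _)) ?_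
    rw [map_pow, norm_pow]
    exact one_lt_pow₀ (IsNormedOver.one_lt_norm (P := P) _ ha) (pow_ne_zero _ Fintype.card_ne_zero)

lemma kappa_mem_overconvergent [IsNormedOver P L] (φ : jComplement P) :
    kappa P (Tate P (1 : Radius L)) φ ∈ overconvergent P L := by
  rw [← kappa_comp (overconvergent P L).val]
  exact (kappa P (overconvergent P L) φ).2

end Frobenius

section FrobeniusEquation

variable {F K : Type*} [Field F] [Field K] [Algebra F K] {P : Place F K}
  [IsDiscreteValuationRing P.ring]
variable {L : Type*} [NormedField L] [Algebra F L]
variable {ι : Type*}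

lemma exists_forall_mem_tateBall [Algebra K L] [IsScalarTower F K L] [Finite ι] {r : ℝ}
    {hr : 0 < r} {x : ι → Tate P (1 : Radius L)} (hx : ∀ i, x i ∈ boundedOn P L r hr) :
    ∃ C, 0 ≤ C ∧ ∀ i, x i ∈ tateBall P L r C := by
  choose C _ hx using hx
  obtain ⟨D, hD⟩ := (Set.finite_range C).bddAbove
  exact ⟨max D 0, le_max_right _ _, fun i ↦
    tateBall_mono r ((hD ⟨i, rfl⟩).trans (le_max_left _ _)) (hx i)⟩

lemma exists_forall_mem_boundedOn [Finite F] [Algebra K L] [IsScalarTower F K L] [Finite ι]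
    {x : ι → Tate P (1 : Radius L)} (hx : ∀ i, x i ∈ overconvergent P L) :
    ∃ (r : ℝ) (hr : 1 < r), ∀ i, x i ∈ boundedOn P L r (one_pos.trans hr) := by
  choose s hs hx using hx
  have eventually_le : ∀ᶠ r in nhdsWithin (1 : ℝ) (Set.Ioi 1), ∀ i, r ≤ s i :=
    Filter.eventually_all.2 fun i ↦ Filter.mem_of_superset (Ioc_mem_nhdsGT (hs i)) fun _ h ↦ h.2
  obtain ⟨r, hr, hrs⟩ := (eventually_mem_nhdsWithin.and eventually_le).exists
  exact ⟨r, hr, fun i ↦ boundedOn_anti (le_of_lt hr) (hrs i) _ _ (hx i)⟩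

lemma exists_one_lt_forall_mem_tateBall [Finite F] {r₀ C δ ε : ℝ} (hr₀ : 1 < r₀) (hC : 0 ≤ C)
    (hδ : 0 ≤ δ) (hδε : δ < ε) {x : ι → Tate P (1 : Radius L)}
    (hx : ∀ i, x i ∈ tateBall P L r₀ C) (hxδ : ∀ i, ‖x i‖ ≤ δ) :
    ∃ r, 1 < r ∧ r ≤ r₀ ∧ ∀ i, x i ∈ tateBall P L r ε := by
  have hε : 0 < ε := hδ.trans_lt hδε
  obtain ⟨δ', hδδ', hδ'ε⟩ := exists_between hδε
  obtain ⟨N, hN⟩ := exists_pow_lt_of_lt_one (show 0 < ε / (C + 1) by positivity)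
    ((div_lt_one hε).2 hδ'ε)
  obtain ⟨r, hr, hrN⟩ := exists_one_lt_pow_le hr₀ (N + 1)
  refine ⟨r, hr, (le_self_pow₀ hr.le N.succ_ne_zero).trans hrN, fun i ↦ ?_⟩
  refine mem_tateBall_of_interpolate hr.le hC hε.le ?_ ((hxδ i).trans_lt hδδ')
    (tateBall_anti_radius (one_le_pow₀ hr.le) hrN (hx i))
  rw [div_pow, div_lt_div_iff₀ (by positivity) (by positivity)] at hN
  have : 0 ≤ δ' ^ N := pow_nonneg (hδ.trans hδδ'.le) N
  calc δ' ^ N * C ≤ δ' ^ N * (C + 1) := by gcongr; exact le_add_of_nonneg_right zero_le_one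
    _ ≤ ε ^ (N + 1) := by rw [pow_succ']; exact hN.le

variable [Fintype F] [Fintype ι]

/-- The semilinear map `u ↦ Φ · τ(u)` on vectors with entries in `L⟨A⟩`. -/
def mulVecTau (Φ : Matrix ι ι (Tate P (1 : Radius L))) :
    (ι → Tate P (1 : Radius L)) →+ (ι → Tate P (1 : Radius L)) :=
  Φ.mulVecLin.toAddMonoidHom.comp ((Tate.tau 1).toAddMonoidHom.compLeft ι)

variable {Φ : Matrix ι ι (Tate P (1 : Radius L))} {u f : ι → Tate P (1 : Radius L)}

lemma mulVecTau_apply (Φ : Matrix ι ι (Tate P (1 : Radius L))) (u : ι → Tate P (1 : Radius L))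
    (i : ι) : mulVecTau Φ u i = ∑ j, Φ i j * Tate.tau 1 (u j) := rfl

lemma mulVecTau_mem_boundedOn [Algebra K L] [IsScalarTower F K L] {r : ℝ} (hr : 1 ≤ r)
    {hr₀ : 0 < r} (hΦ : ∀ i j, Φ i j ∈ boundedOn P L r hr₀)
    (hu : ∀ i, u i ∈ boundedOn P L r hr₀) (i : ι) :
    mulVecTau Φ u i ∈ boundedOn P L r hr₀ :=
  sum_mem fun j _ ↦ mul_mem (hΦ i j) <|
    boundedOn_anti hr (le_self_pow₀ hr Fintype.card_ne_zero) _ _ (tau_mem_boundedOn (hu j))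

section Contraction

variable {r₀ C : ℝ} (hΦ : ∀ i j, Φ i j ∈ tateBall P L r₀ C) (hC : 1 ≤ C)

include hΦ hC

lemma mulVecTau_mem_tateBall_half {r c : ℝ} (hr : 1 ≤ r) (hr₀ : r ≤ r₀) (hc : 0 ≤ c)
    (hcC : C * c ≤ 1 / 2) (hu : ∀ i, u i ∈ tateBall P L r c) (i : ι) :
    mulVecTau Φ u i ∈ tateBall P L r (c / 2) := by
  have : 0 < r := one_pos.trans_le hr
  have c_le_one : c ≤ 1 := by nlinarith
  have bound : C * c ^ Fintype.card F ≤ c / 2 := by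
    calc C * c ^ Fintype.card F ≤ C * c ^ 2 := by
          gcongr C * ?_
          exact pow_le_pow_of_le_one hc c_le_one Fintype.one_lt_card
      _ = C * c * c := by ring
      _ ≤ 1 / 2 * c := by gcongr
      _ = c / 2 := by ring
  refine tateBall_mono r bound (sum_mem fun j _ ↦ mul_mem_tateBall this (by positivity)
    (tateBall_anti_radius hr hr₀ (hΦ i j)) ?_)
  exact tateBall_anti_radius hr (le_self_pow₀ hr Fintype.card_ne_zero)
    (tau_mem_tateBall this (hu j))

lemma iterate_mulVecTau_mem_tateBall {r c : ℝ} (hr : 1 ≤ r) (hr₀ : r ≤ r₀) (hc : 0 ≤ c)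
    (hcC : C * c ≤ 1 / 2) (hu : ∀ i, u i ∈ tateBall P L r c) (n : ℕ) (i : ι) :
    (mulVecTau Φ)^[n] u i ∈ tateBall P L r (c / 2 ^ n) := by
  induction n generalizing i with
  | zero => simpa only [Function.iterate_zero, id_eq, pow_zero, div_one] using hu i
  | succ n ih =>
    rw [Function.iterate_succ_apply', pow_succ, ← div_div]
    refine mulVecTau_mem_tateBall_half hΦ hC hr hr₀ (by positivity) (le_trans ?_ hcC) ih i
    gcongr
    exact div_le_self hc (one_le_pow₀ one_le_two)

lemma iterate_mulVecTau_mem_tateBall_max {r c D : ℝ} (hr : 1 ≤ r) (hr₀ : r ≤ r₀) (hc : 0 ≤ c)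
    (hcC : C * c ≤ 1 / 2) (hu : ∀ i, u i ∈ tateBall P L r D)
    (hΦu : ∀ i, (mulVecTau Φ u - u) i ∈ tateBall P L r c) (n : ℕ) (i : ι) :
    (mulVecTau Φ)^[n] u i ∈ tateBall P L r (max D c) := by
  induction n with
  | zero => exact tateBall_mono r (le_max_left _ _) (hu i)
  | succ n ih =>
    rw [Function.iterate_succ_apply, ← add_sub_cancel u (mulVecTau Φ u), iterate_map_add]
    refine add_mem ih (tateBall_mono r ?_
      (iterate_mulVecTau_mem_tateBall hΦ hC hr hr₀ hc hcC hΦu n i))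
    exact (div_le_self hc (one_le_pow₀ one_le_two)).trans (le_max_right _ _)

lemma norm_mulVecTau_sub_self_le {c : ℝ} (hr₀ : 1 ≤ r₀) (hc : 0 ≤ c) (hcC : C * c ≤ 1 / 2)
    (hf : mulVecTau Φ f = f) (hfu : ∀ i, (f - u) i ∈ tateBall P L 1 c) (i : ι) :
    ‖(mulVecTau Φ u - u) i‖ ≤ c := by
  have error_eq : mulVecTau Φ u - u = (f - u) - mulVecTau Φ (f - u) := by rw [map_sub, hf]; abel
  rw [error_eq]
  exact norm_le_of_mem_tateBall le_rfl hc (sub_mem (hfu i) (tateBall_mono 1 (half_le_self hc)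
    (mulVecTau_mem_tateBall_half hΦ hC le_rfl hr₀ hc hcC hfu i)))

lemma tendsto_iterate_mulVecTau {c : ℝ} (hr₀ : 1 ≤ r₀) (hc : 0 ≤ c) (hcC : C * c ≤ 1 / 2)
    (hf : mulVecTau Φ f = f) (hfu : ∀ i, (f - u) i ∈ tateBall P L 1 c) (i : ι) :
    Filter.Tendsto (fun n ↦ (mulVecTau Φ)^[n] u i) Filter.atTop (nhds (f i)) := by
  have bound_tendsto : Filter.Tendsto (fun n : ℕ ↦ c / 2 ^ n) Filter.atTop (nhds 0) :=
    tendsto_const_nhds.div_atTop (tendsto_pow_atTop_atTop_of_one_lt one_lt_two)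
  have error_tendsto : Filter.Tendsto (fun n ↦ (mulVecTau Φ)^[n] (f - u) i) Filter.atTop
      (nhds 0) :=
    squeeze_zero_norm (fun n ↦ norm_le_of_mem_tateBall le_rfl (by positivity)
      (iterate_mulVecTau_mem_tateBall hΦ hC le_rfl hr₀ hc hcC hfu n i)) bound_tendsto
  simpa only [iterate_map_sub, Function.iterate_fixed hf, Pi.sub_apply, sub_sub_cancel,
    sub_zero] using error_tendsto.const_sub (f i)

end Contraction

variable [Algebra K L] [IsScalarTower F K L]

/- Let `u` be a polynomial approximation of `f`. The error `Φ τ(u) - u` is small at radius `1`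
and bounded at radius `r₀`, hence small at some radius `r > 1` by interpolation. Small vectors are
contracted by `Φ τ` at the radius `r`, so the iterates of `u`, which tend to `f`, are bounded
there. -/
theorem mem_overconvergent_of_mulVecTau_eq (hΦ : ∀ i j, Φ i j ∈ overconvergent P L)
    (hf : mulVecTau Φ f = f) (i : ι) : f i ∈ overconvergent P L := by
  obtain ⟨r₀, hr₀, hΦ⟩ := exists_forall_mem_boundedOn (x := fun p : ι × ι ↦ Φ p.1 p.2)
    fun p ↦ hΦ p.1 p.2
  obtain ⟨C₀, -, hΦC₀⟩ := exists_forall_mem_tateBall hΦ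
  set C := max C₀ 1
  have hC : 1 ≤ C := le_max_right _ _
  have hΦC (i j) : Φ i j ∈ tateBall P L r₀ C := tateBall_mono r₀ (le_max_left _ _) (hΦC₀ (i, j))
  obtain ⟨c, hc, hcC⟩ : ∃ c, 0 < c ∧ C * c ≤ 1 / 2 :=
    ⟨1 / (2 * C), by positivity, by field_simp; rfl⟩
  have hcC_half : C * (c / 2) ≤ 1 / 2 := by nlinarith
  choose p hp using fun i ↦ Metric.denseRange_iff.1 (Tate.denseRange_of 1) (f i) (c / 2)
    (half_pos hc)
  set u : ι → Tate P (1 : Radius L) := fun i ↦ Tate.of 1 (p i)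
  have hfu (i) : (f - u) i ∈ tateBall P L 1 (c / 2) :=
    mem_tateBall_one_of_norm_lt ((dist_eq_norm (f i) (u i)).symm.trans_lt (hp i))
  have hu (i) : u i ∈ boundedOn P L r₀ (one_pos.trans hr₀) :=
    exists_of_mem_tateBall (one_pos.trans hr₀) (p i)
  obtain ⟨D, -, hD⟩ := exists_forall_mem_tateBall hu
  obtain ⟨E, hE, error_mem⟩ := exists_forall_mem_tateBall (x := mulVecTau Φ u - u) fun i ↦
    sub_mem (mulVecTau_mem_boundedOn hr₀.le (fun i j ↦ hΦ (i, j)) hu i) (hu i)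
  obtain ⟨r, hr, hrr₀, error_mem'⟩ := exists_one_lt_forall_mem_tateBall hr₀ hE (half_pos hc).le
    (half_lt_self hc) error_mem
    (norm_mulVecTau_sub_self_le hΦC hC hr₀.le (half_pos hc).le hcC_half hf hfu)
  refine ⟨r, hr, max D c, hc.le.trans (le_max_right _ _), (isClosed_tateBall r _).mem_of_tendsto
    (tendsto_iterate_mulVecTau hΦC hC hr₀.le (half_pos hc).le hcC_half hf hfu i)
    (.of_forall fun n ↦ ?_)⟩
  exact iterate_mulVecTau_mem_tateBall_max hΦC hC hr.le hrr₀ hc.le hcC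
    (fun i ↦ tateBall_anti_radius hr.le hrr₀ (hD i)) error_mem' n i

end FrobeniusEquation

section Poles

variable {F K : Type*} [Field F] [Field K] [Algebra F K]

lemma exists_regularAway_notMem_ring [Finite F] (P : Place F K) [IsDiscreteValuationRing P.ring]
    [IsFractionRing (regularAway P) K] : ∃ a : regularAway P, (a : K) ∉ P.ring := by
  cases nonempty_fintype F
  by_contra! h
  refine P.ne_top (eq_top_iff.2 fun x _ ↦ ?_)
  obtain ⟨a, b, hb, rfl⟩ := IsFractionRing.div_surjective (A := regularAway P) x
  have hb₀ : (b : K) ≠ 0 := by simpa using nonZeroDivisors.ne_zero hb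
  have val_b : val P (b : K) = 1 := le_antisymm (val_le_one_iff.2 (h b)) (one_le_val b.2 hb₀)
  change (a : K) / (b : K) ∈ P.ring
  rw [← val_le_one_iff, map_div₀, val_b, div_one]
  exact val_le_one_iff.2 (h a)

variable [Fintype F] {P : Place F K}

lemma jTwist_zero : jTwist P 0 = jIdeal P := Ideal.map_id _

lemma map_tau_jTwist (i : ℕ) : (jTwist P i).map (tau P K) = jTwist P (i + 1) := by
  rw [jTwist, jTwist, pow_succ']
  exact Ideal.map_map _ _

lemma JIdeal_succ (m : ℕ) : JIdeal P (m + 1) = (JIdeal P m).map (tau P K) * jIdeal P := by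
  rw [JIdeal, JIdeal, Finset.prod_range_succ', jTwist_zero, ← Ideal.mapHom_apply, map_prod]
  simp only [Ideal.mapHom_apply, map_tau_jTwist]

lemma mk_sub_mk_mem_jTwist (a : regularAway P) (i : ℕ) :
    AT.mk a 1 - AT.mk 1 ((a : K) ^ Fintype.card F ^ i) ∈ jTwist P i := by
  induction i with
  | zero =>
    rw [jTwist_zero, pow_zero, pow_one, jIdeal, RingHom.mem_ker, map_sub, sub_eq_zero]
    exact (Algebra.TensorProduct.productMap_apply_tmul _ _ _ _).trans
      ((mul_comm _ _).trans (Algebra.TensorProduct.productMap_apply_tmul _ _ _ _).symm)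
  | succ i ih =>
    rw [← map_tau_jTwist]
    simpa only [map_sub, tau_mk, one_pow, ← pow_mul, ← pow_succ] using
      Ideal.mem_map_of_mem (tau P K) ih

lemma exists_mem_poleSet_mem_JIdeal_pow (P : Place F K) [IsDiscreteValuationRing P.ring]
    [IsFractionRing (regularAway P) K] (m n : ℕ) : ∃ s ∈ poleSet P, s ∈ JIdeal P m ^ n := by
  obtain ⟨a, ha⟩ := exists_regularAway_notMem_ring P
  refine ⟨(∏ i ∈ Finset.range (m + 1), (AT.mk a 1 - AT.mk 1 ((a : K) ^ Fintype.card F ^ i))) ^ n,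
    pow_mem (Submonoid.prod_mem (poleSet P) fun i _ ↦ Submonoid.subset_closure ⟨a, ha, i, rfl⟩) n,
    Ideal.pow_mem_pow (Ideal.prod_mem_prod fun i _ ↦ mk_sub_mk_mem_jTwist a i) n⟩

variable [IsDiscreteValuationRing P.ring]
variable {L : Type*} [NormedField L] [Algebra F L] [Algebra K L] [IsScalarTower F K L]

lemma smul_tau_mem_boundedOn {I : Ideal (AT P K)} {r : ℝ} {hr : 0 < r}
    {x : Tate P (1 : Radius L)} (hx : ∀ g ∈ I, g • x ∈ boundedOn P L r hr) :
    ∀ g ∈ I.map (tau P K), g • Tate.tau 1 x ∈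
      boundedOn P L (r ^ Fintype.card F) (pow_pos hr _) := by
  suffices h : I.map (tau P K) ≤ (Subalgebra.toSubmodule
      (boundedOn P L (r ^ Fintype.card F) (pow_pos hr _))).colon {Tate.tau 1 x} from
    fun g hg ↦ Submodule.mem_colon_singleton.1 (h hg)
  refine Ideal.map_le_iff_le_comap.2 fun g hg ↦ Submodule.mem_colon_singleton.2 ?_
  rw [Algebra.smul_def, ← Tate.tau_algebraMap, ← map_mul, ← Algebra.smul_def]
  exact tau_mem_boundedOn (hx g hg)

/- Each application of `f = Φ · τ(f)` raises the radius to the `q`-th power and replaces `J_m` by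
`τ J_m + 𝔧 = J_(m+1)`. -/
theorem smul_mem_boundedOn_of_mulVecTau_eq {ι : Type*} [Fintype ι]
    {Φ : Matrix ι ι (Tate P (1 : Radius L))} {f : ι → Tate P (1 : Radius L)} {n : ℕ}
    (hΦ : ∀ g ∈ jIdeal P ^ n, ∀ i j, g • Φ i j ∈ (⊥ : Subalgebra (AT P K) (Tate P 1)))
    (hf : mulVecTau Φ f = f) {r : ℝ} (hr : 0 < r) (hfr : ∀ i, f i ∈ boundedOn P L r hr) (m : ℕ) :
    ∀ g ∈ JIdeal P m ^ n, ∀ i, g • f i ∈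
      boundedOn P L (r ^ Fintype.card F ^ m) (pow_pos hr _) := by
  induction m with
  | zero =>
    simp only [pow_zero, pow_one]
    exact fun g _ i ↦ Subalgebra.smul_mem _ (hfr i) g
  | succ m ih =>
    intro g hg i
    suffices h : JIdeal P (m + 1) ^ n ≤ (Subalgebra.toSubmodule (boundedOn P L
        (r ^ Fintype.card F ^ (m + 1)) (pow_pos hr _))).colon {f i} from
      Submodule.mem_colon_singleton.1 (h hg)
    rw [JIdeal_succ, mul_pow, ← Ideal.map_pow, Ideal.mul_le]
    refine fun g hg h hh ↦ Submodule.mem_colon_singleton.2 ?_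
    rw [← congrFun hf i, mulVecTau_apply, Finset.smul_sum, mul_comm]
    refine sum_mem fun j _ ↦ ?_
    rw [← smul_mul_smul_comm]
    simp only [pow_succ, pow_mul]
    exact Subalgebra.mul_mem _ ((bot_le : (⊥ : Subalgebra _ _) ≤ _) (hΦ h hh i j))
      (smul_tau_mem_boundedOn (fun g hg ↦ ih g hg j) g hg)

end Poles

section Meromorphic

variable {F K : Type*} [Field F] [Fintype F] [Field K] [Algebra F K] {P : Place F K}
  [IsDiscreteValuationRing P.ring]
variable {L : Type*} [NormedField L] [Algebra F L] [Algebra K L] [IsScalarTower F K L]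

lemma Mer.restrict_algebraMap_tate {ρ ρ' : Radius L} (h : ρ ≤ ρ') (x : Tate P ρ') :
    Mer.restrict h (algebraMap (Tate P ρ') (Mer P ρ') x) =
      algebraMap (Tate P ρ) (Mer P ρ) (Tate.restrict h x) :=
  IsLocalization.map_eq (M := Algebra.algebraMapSubmonoid (Tate P ρ') (poleSet P))
    (T := Algebra.algebraMapSubmonoid (Tate P ρ) (poleSet P)) (Q := Mer P ρ)
    (g := (Tate.restrict (P := P) h).toRingHom) (by
      rintro _ ⟨s, hs, rfl⟩
      exact ⟨s, hs, ((Tate.restrict (P := P) h).commutes s).symm⟩) x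

lemma Mer.tau_algebraMap_tate (ρ : Radius L) (x : Tate P ρ) :
    Mer.tau ρ (algebraMap (Tate P ρ) (Mer P ρ) x) =
      algebraMap (Tate P ρ) (Mer P ρ) (Tate.tau ρ x) :=
  IsLocalization.map_eq _ _

lemma Mer.ringHom_ext {ρ : Radius L} {E : Type*} [CommRing E] {f g : Mer P ρ →+* E}
    (h : ∀ x, f (algebraMap (Tate P ρ) _ x) = g (algebraMap (Tate P ρ) _ x)) : f = g :=
  IsLocalization.ringHom_ext (Algebra.algebraMapSubmonoid (Tate P ρ) (poleSet P)) (RingHom.ext h)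

lemma Mer.restrict_restrict {ρ ρ' ρ'' : Radius L} (h : ρ ≤ ρ') (h' : ρ' ≤ ρ'') (h'' : ρ ≤ ρ'')
    (x : Mer P ρ'') : Mer.restrict h (Mer.restrict h' x) = Mer.restrict h'' x := by
  refine RingHom.congr_fun
    (f := ((Mer.restrict h).comp (Mer.restrict h') : _ →ₐ[AT P K] Mer P ρ).toRingHom)
    (g := (Mer.restrict h'' : _ →ₐ[AT P K] Mer P ρ).toRingHom) (ringHom_ext fun y ↦ ?_) x
  simp only [AlgHom.toRingHom_eq_coe, RingHom.coe_coe, AlgHom.comp_apply,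
    restrict_algebraMap_tate, Tate.restrict_restrict h h' h'']

lemma Mer.restrict_tau {ρ ρ' : Radius L} (h : ρ ≤ ρ') (x : Mer P ρ') :
    Mer.restrict h (Mer.tau ρ' x) = Mer.tau ρ (Mer.restrict h x) := by
  refine RingHom.congr_fun
    (f := (Mer.restrict h : _ →ₐ[AT P K] Mer P ρ).toRingHom.comp (Mer.tau ρ'))
    (g := (Mer.tau ρ).comp (Mer.restrict h : _ →ₐ[AT P K] Mer P ρ).toRingHom)
    (ringHom_ext fun y ↦ ?_) x
  simp only [AlgHom.toRingHom_eq_coe, RingHom.comp_apply, RingHom.coe_coe,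
    tau_algebraMap_tate, restrict_algebraMap_tate, Tate.restrict_tau]

lemma Mer.restrict_injective {ρ ρ' : Radius L} (h : ρ ≤ ρ') :
    Function.Injective (Mer.restrict (P := P) h) := by
  refine IsLocalization.injective_of_map_algebraMap_zero (R := Tate P ρ')
    (M := Algebra.algebraMapSubmonoid (Tate P ρ') (poleSet P)) _
    (Mer.restrict h : _ →ₐ[AT P K] Mer P ρ).toRingHom fun y hy ↦ ?_
  rw [AlgHom.toRingHom_eq_coe, RingHom.coe_coe, restrict_algebraMap_tate,
    IsLocalization.map_eq_zero_iff (Algebra.algebraMapSubmonoid (Tate P ρ) (poleSet P))] at hy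
  obtain ⟨⟨_, s, hs, rfl⟩, hsy : algebraMap (AT P K) _ s * Tate.restrict h y = 0⟩ := hy
  rw [← AlgHom.commutes (Tate.restrict h), ← map_mul,
    map_eq_zero_iff _ (Tate.restrict_injective h)] at hsy
  refine (IsLocalization.map_eq_zero_iff
    (Algebra.algebraMapSubmonoid (Tate P ρ') (poleSet P)) _ y).2 ⟨⟨_, s, hs, rfl⟩, hsy⟩

/- An element of `poleSet` in the ideal of `n · J_m` serves as the denominator of `f` on `𝔛_ρ`. -/
lemma exists_sectionsOn_restrict_eq [IsFractionRing (regularAway P) K] {n m : ℕ} {ρ : Radius L}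
    {f : Tate P (1 : Radius L)}
    (hf : ∀ g ∈ JIdeal P m ^ n, ∃ y, Tate.restrict ρ.one_le y = g • f) :
    ∃ x ∈ sectionsOn n ρ,
      Mer.restrict ρ.one_le x = algebraMap (Tate P (1 : Radius L)) (Mer P (1 : Radius L)) f := by
  obtain ⟨s, hs, hsJ⟩ := exists_mem_poleSet_mem_JIdeal_pow P m n
  obtain ⟨y, hy⟩ := hf s hsJ
  obtain ⟨u, hu⟩ := PolesInvertible.isUnit (E := Mer P ρ) s hs
  have restrict_eq : Mer.restrict ρ.one_le (algebraMap (Tate P ρ) (Mer P ρ) y * (↑u⁻¹ : Mer P ρ)) =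
      algebraMap (Tate P (1 : Radius L)) (Mer P (1 : Radius L)) f := by
    refine (PolesInvertible.isUnit (E := Mer P (1 : Radius L)) s hs).mul_right_cancel ?_
    rw [← AlgHom.commutes (Mer.restrict (P := P) ρ.one_le), ← map_mul, ← hu, mul_assoc,
      Units.inv_mul, mul_one, Mer.restrict_algebraMap_tate, hy, Algebra.smul_def, map_mul,
      ← IsScalarTower.algebraMap_apply, hu, AlgHom.commutes, mul_comm]
  refine ⟨_, ⟨m, fun g hg ↦ ?_⟩, restrict_eq⟩
  obtain ⟨z, hz⟩ := hf g hg
  refine ⟨z, Mer.restrict_injective ρ.one_le ?_⟩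
  rw [map_smul, restrict_eq, Mer.restrict_algebraMap_tate, hz, Algebra.smul_def, map_mul,
    ← IsScalarTower.algebraMap_apply, Algebra.smul_def]

lemma globalSections.restrict_eval {n : ℕ} {ρ ρ' : Radius L} (h : ρ ≤ ρ')
    (x : globalSections P L n) :
    Mer.restrict h (globalSections.eval n ρ' x) = globalSections.eval n ρ x :=
  x.2.2 ρ ρ' h

variable [IsNormedOver P L]

lemma tateEquivMer_apply (x : Tate P (1 : Radius L)) :
    tateEquivMer x = algebraMap (Tate P (1 : Radius L)) (Mer P (1 : Radius L)) x := rfl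

lemma tateEquivMer_toTate (n : ℕ) (x : globalSections P L n) :
    tateEquivMer (globalSections.toTate n x) = globalSections.eval n 1 x :=
  tateEquivMer.apply_symm_apply _

lemma globalSections.toTate_injective (n : ℕ) :
    Function.Injective (globalSections.toTate (P := P) (L := L) n) := by
  refine fun x y hxy ↦ Subtype.ext (funext fun ρ ↦ Mer.restrict_injective ρ.one_le ?_)
  exact (restrict_eval _ x).trans ((tateEquivMer.symm.injective hxy).trans (restrict_eval _ y).symm)

lemma globalSections.exists_toTate_eq {n : ℕ} {f : Tate P (1 : Radius L)}
    (hf : ∀ ρ : Radius L, ∃ x ∈ sectionsOn n ρ,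
      Mer.restrict ρ.one_le x = algebraMap (Tate P (1 : Radius L)) (Mer P (1 : Radius L)) f) :
    ∃ x : globalSections P L n, globalSections.toTate n x = f := by
  choose x hx hxf using hf
  have compatible (ρ ρ' : Radius L) (h : ρ ≤ ρ') : Mer.restrict h (x ρ') = x ρ := by
    refine Mer.restrict_injective ρ.one_le ?_
    rw [Mer.restrict_restrict _ _ ρ'.one_le, hxf, hxf]
  refine ⟨⟨x, hx, compatible⟩, (tateEquivMer (P := P) (L := L)).injective ?_⟩
  rw [tateEquivMer_toTate, tateEquivMer_apply, ← hxf 1]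
  exact (compatible 1 1 _).symm

end Meromorphic

section Coordinates

variable {R M : Type*} [CommRing R] [AddCommGroup M] [Module R M]

lemma rTensor_toLinearMap_smul {E E' : Type*} [CommRing E] [Algebra R E] [CommRing E']
    [Algebra R E'] (g : E →ₐ[R] E') (e : E) (x : E ⊗[R] M) :
    g.toLinearMap.rTensor M (e • x) = g e • g.toLinearMap.rTensor M x := by
  induction x using TensorProduct.induction_on with
  | zero => simp
  | tmul a m => simp [TensorProduct.smul_tmul']
  | add x y hx hy => rw [smul_add, map_add, hx, hy, map_add, smul_add]

lemma dual_baseChange_rTensor {E E' : Type*} [CommRing E] [Algebra R E] [CommRing E']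
    [Algebra R E'] (g : E →ₐ[R] E') (l : Module.Dual R M) (x : E ⊗[R] M) :
    l.baseChange E' (g.toLinearMap.rTensor M x) = g (l.baseChange E x) := by
  induction x using TensorProduct.induction_on with
  | zero => simp
  | tmul e m => simp
  | add x y hx hy => simp only [map_add, hx, hy]

lemma exists_forall_eq_sum_dual_smul (R M : Type*) [CommRing R] [AddCommGroup M] [Module R M]
    [Module.Finite R M] [Module.Projective R M] :
    ∃ (k : ℕ) (l : Fin k → Module.Dual R M) (v : Fin k → M), ∀ m, m = ∑ i, l i m • v i := by
  obtain ⟨k, f, g, -, -, hfg⟩ := Module.Finite.exists_comp_eq_id_of_projective R M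
  refine ⟨k, fun i ↦ LinearMap.proj i ∘ₗ g, fun i ↦ f (Pi.basisFun R _ i), fun m ↦ ?_⟩
  calc m = f (g m) := (LinearMap.congr_fun hfg m).symm
    _ = f (∑ i, g m i • Pi.basisFun R _ i) := congrArg f ((Pi.basisFun R _).sum_equivFun (g m)).symm
    _ = ∑ i, g m i • f (Pi.basisFun R _ i) := by simp only [map_sum, map_smul]

lemma eq_sum_dual_baseChange_tmul {E : Type*} [CommRing E] [Algebra R E] {ι : Type*} [Fintype ι]
    {l : ι → Module.Dual R M} {v : ι → M} (hlv : ∀ m, m = ∑ i, l i m • v i) (x : E ⊗[R] M) :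
    x = ∑ i, (l i).baseChange E x ⊗ₜ v i := by
  induction x using TensorProduct.induction_on with
  | zero => simp
  | add x y hx hy =>
    conv_lhs => rw [hx, hy]
    simp only [map_add, TensorProduct.add_tmul, Finset.sum_add_distrib]
  | tmul e m =>
    conv_lhs => rw [hlv m]
    simp only [TensorProduct.tmul_sum, Module.Dual.baseChange_apply_tmul, TensorProduct.smul_tmul]

end Coordinates

section Action

variable {F K : Type*} [Field F] [Fintype F] [Field K] [Algebra F K] {P : Place F K}
variable {M : Type*} [AddCommGroup M] [Module (AT P K) M] (T : MotiveStructure P M)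
variable {E E' : Type*} [CommRing E] [Algebra (AT P K) E] [CommRing E'] [Algebra (AT P K) E']

lemma MotiveStructure.act_tmul (κ : jComplement P →ₐ[AT P K] E) (σ : E →+* E)
    (hσ : ∀ b, σ (algebraMap (AT P K) E b) = algebraMap (AT P K) E (tau P K b))
    (e : E) (m : M) : T.act κ σ hσ (e ⊗ₜ m) = σ e • T.frobVec κ m := rfl

lemma MotiveStructure.rTensor_frobVec (κ : jComplement P →ₐ[AT P K] E) (g : E →ₐ[AT P K] E')
    (m : M) : g.toLinearMap.rTensor M (T.frobVec κ m) = T.frobVec (g.comp κ) m := by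
  change g.toLinearMap.rTensor M (κ.toLinearMap.rTensor M _) = _
  rw [← LinearMap.comp_apply, ← LinearMap.rTensor_comp]
  rfl

lemma MotiveStructure.rTensor_act (κ : jComplement P →ₐ[AT P K] E) (σ : E →+* E)
    (hσ : ∀ b, σ (algebraMap (AT P K) E b) = algebraMap (AT P K) E (tau P K b))
    (σ' : E' →+* E')
    (hσ' : ∀ b, σ' (algebraMap (AT P K) E' b) = algebraMap (AT P K) E' (tau P K b))
    (g : E →ₐ[AT P K] E') (hg : ∀ x, g (σ x) = σ' (g x)) (x : E ⊗[AT P K] M) :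
    g.toLinearMap.rTensor M (T.act κ σ hσ x) =
      T.act (g.comp κ) σ' hσ' (g.toLinearMap.rTensor M x) := by
  induction x using TensorProduct.induction_on with
  | zero => simp
  | add x y hx hy => simp only [map_add, hx, hy]
  | tmul e m =>
    rw [act_tmul, rTensor_toLinearMap_smul, hg, rTensor_frobVec, LinearMap.rTensor_tmul, act_tmul]
    rfl

end Action

section Solutions

variable {F K : Type*} [Field F] [Fintype F] [Field K] [Algebra F K] {P : Place F K}

lemma exists_forall_smul_mem_bot {ι : Type*} [Finite ι] (φ : ι → jComplement P) :
    ∃ n₀ : ℕ, ∀ n ≥ n₀, ∀ g ∈ jIdeal P ^ n, ∀ i,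
      g • φ i ∈ (⊥ : Subalgebra (AT P K) (jComplement P)) := by
  choose N hN using fun i ↦ (φ i).2
  obtain ⟨n₀, hn₀⟩ := (Set.finite_range N).bddAbove
  refine ⟨n₀, fun n hn g hg i ↦ ?_⟩
  obtain ⟨b, hb⟩ := hN i g (Ideal.pow_le_pow_right ((hn₀ ⟨i, rfl⟩).trans hn) hg)
  exact ⟨b, Subtype.ext hb⟩

variable [IsDiscreteValuationRing P.ring]
variable {L : Type*} [NormedField L] [Algebra F L] [Algebra K L] [IsScalarTower F K L]
  [IsNormedOver P L]
variable {M : Type*} [AddCommGroup M] [Module (AT P K) M] (T : MotiveStructure P M)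

lemma exists_forall_toTate_eq_of_mulVecTau_eq [IsFractionRing (regularAway P) K] {ι : Type*}
    [Fintype ι] {n : ℕ} {Φ : Matrix ι ι (Tate P (1 : Radius L))}
    {f : ι → Tate P (1 : Radius L)} (hΦ : ∀ i j, Φ i j ∈ overconvergent P L)
    (hΦJ : ∀ g ∈ jIdeal P ^ n, ∀ i j,
      g • Φ i j ∈ (⊥ : Subalgebra (AT P K) (Tate P (1 : Radius L))))
    (hf : mulVecTau Φ f = f) (i : ι) :
    ∃ y : globalSections P L n, globalSections.toTate n y = f i := by
  obtain ⟨r, hr, hfr⟩ :=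
    exists_forall_mem_boundedOn (mem_overconvergent_of_mulVecTau_eq hΦ hf)
  refine globalSections.exists_toTate_eq fun ρ ↦ ?_
  obtain ⟨m, hm⟩ := pow_unbounded_of_one_lt (ρ.1 ^ 2) hr
  have radius_le : ρ.1 ^ 2 ≤ r ^ Fintype.card F ^ m :=
    hm.le.trans (pow_le_pow_right₀ hr.le (Nat.lt_pow_self Fintype.one_lt_card).le)
  refine exists_sectionsOn_restrict_eq (m := m) fun g hg ↦ ?_
  obtain ⟨C, hC, hgf⟩ := smul_mem_boundedOn_of_mulVecTau_eq hΦJ hf _ hfr m g hg i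
  exact exists_restrict_eq_of_mem_tateBall ρ radius_le hC hgf

lemma MotiveStructure.mulVecTau_dual_baseChange {ι : Type*} [Fintype ι]
    {l : ι → Module.Dual (AT P K) M} {v : ι → M} (hlv : ∀ m, m = ∑ i, l i m • v i)
    (x : Tate P (1 : Radius L) ⊗[AT P K] M) :
    mulVecTau (.of fun i j ↦ kappa P (Tate P (1 : Radius L))
      ((l i).baseChange (jComplement P) (T.frob (1 ⊗ₜ v j)))) (fun i ↦ (l i).baseChange _ x) =
      fun i ↦ (l i).baseChange _ (T.tateAct P L x) := by
  ext i
  conv_rhs => rw [eq_sum_dual_baseChange_tmul hlv x, map_sum, map_sum]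
  rw [mulVecTau_apply]
  refine Finset.sum_congr rfl fun j _ ↦ ?_
  rw [tateAct, act_tmul, map_smul, smul_eq_mul, mul_comm, Matrix.of_apply,
    ← dual_baseChange_rTensor]
  rfl

lemma MotiveStructure.exists_rTensor_toTate_eq_of_mem_tateFixed
    [IsFractionRing (regularAway P) K] [Module.Finite (AT P K) M]
    [Module.Projective (AT P K) M] :
    ∃ n₀ : ℕ, ∀ n ≥ n₀, ∀ x ∈ T.tateFixed L,
      ∃ y : globalSections P L n ⊗[AT P K] M, (globalSections.toTate n).rTensor M y = x := by
  obtain ⟨k, l, v, hlv⟩ := exists_forall_eq_sum_dual_smul (AT P K) M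
  let φ (i j : Fin k) : jComplement P := (l i).baseChange _ (T.frob (1 ⊗ₜ v j))
  obtain ⟨n₀, hn₀⟩ := exists_forall_smul_mem_bot fun p : Fin k × Fin k ↦ φ p.1 p.2
  refine ⟨n₀, fun n hn x hx ↦ ?_⟩
  have poles_le : ∀ g ∈ jIdeal P ^ n, ∀ i j, g • kappa P (Tate P (1 : Radius L)) (φ i j) ∈
      (⊥ : Subalgebra (AT P K) (Tate P (1 : Radius L))) := fun g hg i j ↦ by
    rw [← map_smul, ← Algebra.map_bot (kappa P (Tate P (1 : Radius L)))]
    exact Subalgebra.mem_map.2 ⟨_, hn₀ n hn g hg (i, j), rfl⟩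
  have coords_eq := (T.mulVecTau_dual_baseChange hlv x).trans
    (congrArg (fun z i ↦ (l i).baseChange _ z) hx)
  choose y hy using exists_forall_toTate_eq_of_mulVecTau_eq
    (fun i j ↦ kappa_mem_overconvergent (φ i j)) poles_le coords_eq
  refine ⟨∑ i, y i ⊗ₜ v i, ?_⟩
  simp only [map_sum, LinearMap.rTensor_tmul, hy]
  exact (eq_sum_dual_baseChange_tmul hlv x).symm

end Solutions

section Isomorphisms

lemma exists_linearEquiv_of_mem_iff {A R X Y : Type*} [Semiring A] [Semiring R] [SMul A R]
    [AddCommMonoid X] [Module R X] [Module A X] [IsScalarTower A R X]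
    [AddCommMonoid Y] [Module R Y] [Module A Y] [IsScalarTower A R Y]
    (g : X →ₗ[R] Y) (hg : Function.Injective g) {U : Submodule A X} {V : Submodule A Y}
    (mem_iff : ∀ x, x ∈ U ↔ g x ∈ V) (hV : ∀ y ∈ V, ∃ x, g x = y) :
    ∃ e : U ≃ₗ[A] V, ∀ x, (e x).1 = g x.1 := by
  have map_eq : U.map (g.restrictScalars A) = V := le_antisymm
    (Submodule.map_le_iff_le_comap.2 fun x ↦ (mem_iff x).1) fun y hy ↦ by
      obtain ⟨x, rfl⟩ := hV y hy
      exact ⟨x, (mem_iff x).2 hy, rfl⟩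
  exact ⟨(Submodule.equivMapOfInjective (g.restrictScalars A) hg U).trans
    (.ofEq _ _ map_eq), fun _ ↦ rfl⟩

variable {F K : Type*} [Field F] [Fintype F] [Field K] [Algebra F K] {P : Place F K}
  [IsDiscreteValuationRing P.ring]
variable {L : Type*} [NormedField L] [Algebra F L] [Algebra K L] [IsScalarTower F K L]
variable {M : Type*} [AddCommGroup M] [Module (AT P K) M] (T : MotiveStructure P M)

lemma MotiveStructure.rTensor_restrict_merAct {ρ ρ' : Radius L} (h : ρ ≤ ρ')
    (x : Mer P ρ' ⊗[AT P K] M) :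
    (Mer.restrict h).toLinearMap.rTensor M (T.merAct ρ' x) =
      T.merAct ρ ((Mer.restrict h).toLinearMap.rTensor M x) := by
  rw [merAct, T.rTensor_act _ _ _ _ (Mer.tau_algebraMap ρ) _ (Mer.restrict_tau h), merAct]
  simp only [kappa_comp]

lemma rTensor_restrict_rTensor_eval {n : ℕ} {ρ ρ' : Radius L} (h : ρ ≤ ρ')
    (x : globalSections P L n ⊗[AT P K] M) :
    (Mer.restrict h).toLinearMap.rTensor M ((globalSections.eval n ρ').rTensor M x) =
      (globalSections.eval n ρ).rTensor M x := by
  rw [← LinearMap.rTensor_comp_apply]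
  exact LinearMap.congr_fun (congrArg _ (LinearMap.ext (globalSections.restrict_eval h))) x

lemma MotiveStructure.merAct_rTensor_eval_iff [Module.Flat (AT P K) M] {n : ℕ} {ρ ρ' : Radius L}
    (h : ρ ≤ ρ') (x : globalSections P L n ⊗[AT P K] M) :
    T.merAct ρ' ((globalSections.eval n ρ').rTensor M x) =
        (globalSections.eval n ρ').rTensor M x ↔
      T.merAct ρ ((globalSections.eval n ρ).rTensor M x) =
        (globalSections.eval n ρ).rTensor M x := by
  have restrict_injective := Module.Flat.rTensor_preserves_injective_linearMap (M := M)
    (Mer.restrict (P := P) h).toLinearMap (Mer.restrict_injective h)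
  rw [← restrict_injective.eq_iff, rTensor_restrict_merAct, rTensor_restrict_rTensor_eval]

variable [IsNormedOver P L]

lemma MotiveStructure.mem_tateFixed_iff (x : Tate P (1 : Radius L) ⊗[AT P K] M) :
    x ∈ T.tateFixed L ↔ T.tateAct P L x = x := Iff.rfl

lemma MotiveStructure.merAct_rTensor_tateEquivMer (x : Tate P (1 : Radius L) ⊗[AT P K] M) :
    T.merAct 1 (tateEquivMer.toLinearMap.rTensor M x) =
      tateEquivMer.toLinearMap.rTensor M (T.tateAct P L x) := by
  have naturality := T.rTensor_act (kappa P _) _ (Tate.tau_algebraMap 1) _ (Mer.tau_algebraMap 1)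
    (IsScalarTower.toAlgHom (AT P K) (Tate P (1 : Radius L)) (Mer P (1 : Radius L)))
    (fun y ↦ (Mer.tau_algebraMap_tate 1 y).symm) x
  simp only [kappa_comp] at naturality
  exact naturality.symm

lemma rTensor_tateEquivMer_rTensor_toTate {n : ℕ} (x : globalSections P L n ⊗[AT P K] M) :
    tateEquivMer.toLinearMap.rTensor M ((globalSections.toTate n).rTensor M x) =
      (globalSections.eval n 1).rTensor M x := by
  rw [← LinearMap.rTensor_comp_apply]
  exact LinearMap.congr_fun (congrArg _ (LinearMap.ext (tateEquivMer_toTate n))) x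

lemma MotiveStructure.mem_globalFixed_iff_rTensor_toTate_mem [Module.Flat (AT P K) M] {n : ℕ}
    (x : globalSections P L n ⊗[AT P K] M) :
    x ∈ T.globalFixed L n ↔ (globalSections.toTate n).rTensor M x ∈ T.tateFixed L := by
  have tateEquivMer_injective := Module.Flat.rTensor_preserves_injective_linearMap (M := M)
    (tateEquivMer (P := P) (L := L)).toLinearMap (LinearEquiv.injective _)
  rw [mem_tateFixed_iff, ← tateEquivMer_injective.eq_iff, ← merAct_rTensor_tateEquivMer,
    rTensor_tateEquivMer_rTensor_toTate]
  exact ⟨fun h ↦ h 1, fun h ρ ↦ (T.merAct_rTensor_eval_iff ρ.one_le x).2 h⟩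

theorem MotiveStructure.exists_globalFixed_equiv_tateFixed [IsFractionRing (regularAway P) K]
    [Module.Finite (AT P K) M] [Module.Projective (AT P K) M] :
    ∃ n₀ : ℕ, ∀ n ≥ n₀, ∃ e : T.globalFixed L n ≃ₗ[regularAway P] T.tateFixed L,
      ∀ x, (e x).1 = (globalSections.toTate n).rTensor M x.1 := by
  obtain ⟨n₀, exists_rTensor_eq⟩ := T.exists_rTensor_toTate_eq_of_mem_tateFixed (L := L)
  refine ⟨n₀, fun n hn ↦ exists_linearEquiv_of_mem_iff _ ?_
    T.mem_globalFixed_iff_rTensor_toTate_mem (exists_rTensor_eq n hn)⟩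
  exact Module.Flat.rTensor_preserves_injective_linearMap _ (globalSections.toTate_injective n)

variable {L' : Type*} [NormedField L'] [Algebra F L'] [Algebra K L'] [IsScalarTower F K L']
  [IsNormedOver P L'] (f : L →ₐ[K] L') (hf : ∀ x, ‖f x‖ = ‖x‖)

lemma MotiveStructure.tateAct_rTensor_baseChange (x : Tate P (1 : Radius L) ⊗[AT P K] M) :
    T.tateAct P L' ((Tate.baseChange f hf).toLinearMap.rTensor M x) =
      (Tate.baseChange f hf).toLinearMap.rTensor M (T.tateAct P L x) := by
  rw [tateAct, tateAct, T.rTensor_act _ _ _ _ (Tate.tau_algebraMap 1) _ (Tate.baseChange_tau f hf)]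
  simp only [kappa_comp]

theorem MotiveStructure.exists_tateFixed_equiv_tateFixed [Module.Flat (AT P K) M]
    (hL : ∀ ω ∈ T.tateFixed L', ω ∈ LinearMap.range
      ((Tate.baseChange f hf).toLinearMap.rTensor M)) :
    ∃ e : T.tateFixed L ≃ₗ[regularAway P] T.tateFixed L',
      ∀ x, (e x).1 = (Tate.baseChange f hf).toLinearMap.rTensor M x.1 := by
  have baseChange_injective := Module.Flat.rTensor_preserves_injective_linearMap (M := M)
    (Tate.baseChange (P := P) f hf).toLinearMap (Tate.baseChange_injective f hf)
  refine exists_linearEquiv_of_mem_iff _ baseChange_injective (fun x ↦ ?_) hL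
  rw [mem_tateFixed_iff, mem_tateFixed_iff, tateAct_rTensor_baseChange, baseChange_injective.eq_iff]

end Isomorphisms

end AMotive

end

theorem mainTheorem11_general {F K : Type*} [Field F] [Fintype F] [Field K] [Algebra F K]
    (P : AMotive.Place F K) [IsDiscreteValuationRing P.ring]
    [IsFractionRing (AMotive.regularAway P) K]
    {M : Type*} [AddCommGroup M] [Module (AMotive.AT P K) M]
    [Module.Finite (AMotive.AT P K) M] [Module.Projective (AMotive.AT P K) M]
    (T : AMotive.MotiveStructure P M)
    {L L' : Type*} [NormedField L] [Algebra F L] [Algebra K L] [IsScalarTower F K L]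
    [AMotive.IsNormedOver P L] [NormedField L'] [Algebra F L'] [Algebra K L']
    [IsScalarTower F K L'] [AMotive.IsNormedOver P L'] (f : L →ₐ[K] L') (hf : ∀ x, ‖f x‖ = ‖x‖)
    (hL : ∀ ω ∈ T.tateFixed L', ω ∈ LinearMap.range
      ((AMotive.Tate.baseChange f hf).toLinearMap.rTensor M)) :
    (∃ e : T.tateFixed L ≃ₗ[AMotive.regularAway P] T.tateFixed L',
      ∀ x, (e x).1 = (AMotive.Tate.baseChange f hf).toLinearMap.rTensor M x.1) ∧
    ∃ n₀ : ℕ, ∀ n ≥ n₀, ∃ e : T.globalFixed L n ≃ₗ[AMotive.regularAway P] T.tateFixed L,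
      ∀ x, (e x).1 = (AMotive.globalSections.toTate n).rTensor M x.1 :=
  ⟨T.exists_tateFixed_equiv_tateFixed f hf hL, T.exists_globalFixed_equiv_tateFixed⟩

theorem mainTheorem11 {F K : Type*} [Field F] [Fintype F] [Field K] [Algebra F K]
    (hK : AMotive.IsCurveFunctionField F K)
    (P : AMotive.Place F K) [IsDiscreteValuationRing P.ring]
    [IsFractionRing (AMotive.regularAway P) K]
    {M : Type*} [AddCommGroup M] [Module (AMotive.AT P K) M]
    [Module.Finite (AMotive.AT P K) M] [Module.Projective (AMotive.AT P K) M]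
    (T : AMotive.MotiveStructure P M) (hT : T.IsRigidAnalyticallyTrivial)
    (L : IntermediateField (AMotive.Kinf P) (AMotive.Ksep P))
    [FiniteDimensional (AMotive.Kinf P) L]
    (hL : ∀ ω ∈ T.betti, ω ∈ LinearMap.range
      ((AMotive.Tate.toCinf L).toLinearMap.rTensor M)) :
    (∃ e : T.tateFixed L ≃ₗ[AMotive.regularAway P] T.betti,
      ∀ x, (e x).1 = (AMotive.Tate.toCinf L).toLinearMap.rTensor M x.1) ∧
    ∃ n₀ : ℕ, ∀ n ≥ n₀, ∃ e : T.globalFixed L n ≃ₗ[AMotive.regularAway P] T.tateFixed L,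
      ∀ x, (e x).1 = (AMotive.globalSections.toTate n).rTensor M x.1 := by
  exact mainTheorem11_general P T (AMotive.inclCinf L)
    (fun x ↦ AMotive.norm_algebraMap_Cinf P (x : AMotive.Ksep P)) hL
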